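/- **Theorem (Completeness of pACP).** For all closed pACP terms $t$ and $t'$: if $t$ and $t'$ are probabilistic bisimulation equivalent, then the equation $t=t'$ is derivable from the axioms of pACP. Here the following is used. *Parameters.* $A$ is an arbitrary set of actions, $\delta\notin A$, $A_\delta=A\cup\{\delta\}$; $\gamma:A_\delta\times A_\delta\to A_\delta$ is an arbitrary commutative and associative function with $\gamma(\delta,a)=\delta$ for all $a\in A_\delta$. $\mathfrak M$ is an arbitrary signed cancellation meadow, i.e. a commutative ring with identity, with a total unary operation ${}^{-1}$ satisfying $(x^{-1})^{-1}=x$, $x\cdot(x\cdot x^{-1})=x$ and the cancellation law $x\ne0\wedge x\cdot y=x\cdot z\Rightarrow y=z$, and with a unary operation $s$ satisfying (with $x/y:=x\cdot y^{-1}$) $s(x/x)=x/x$, $s(1-x/x)=1-x/x$, $s(-1)=-1$, $s(x^{-1})=s(x)$, $s(xy)=s(x)s(y)$ and $\bigl(1-\frac{s(x)-s(y)}{s(x)-s(y)}\bigr)(s(x+y)-s(x))=0$. The set of probabilities is $\mathcal P=\{\pi\in\mathfrak M : s(s(\pi)+1)\cdot s(s(1-\pi)+1)=1\}$ (that is, $0\le\pi\le1$).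 *Terms.* pACP terms are built from a countably infinite set of variables, the constants $a$ ($a\in A$) and $\delta$, the binary operators $+$ (alternative composition), $\cdot$ (sequential composition), $\boxplus_\pi$ for each $\pi\in\mathcal P$ (probabilistic choice), $\parallel$ (parallel composition), $⌊$ (left merge, written $x⌊y$), $\mid$ (communication merge), and the unary operators $\partial_H$ for each $H\subseteq A$ (encapsulation). Closed terms are terms without variables. The operator $+$ binds weakest and $\cdot$ binds strongest. *Axioms* ($a,b$ range over $A_\delta$, $\pi,\rho$ over $\mathcal P$, $H$ over subsets of $A$); derivability is derivability in conditional equational logic. - A1 $x+y=y+x$; A2 $(x+y)+z=x+(y+z)$; A3′ $a+a=a$; A4 $(x+y)\cdot z=x\cdot z+y\cdot z$; A5 $(x\cdot y)\cdot z=x\cdot(y\cdot z)$; A6 $x+\delta=x$; A7 $\delta\cdot x=\delta$. - D1 $\partial_H(a)=a$ if $a\notin H$; D2 $\partial_H(a)=\delta$ if $a\in H$; D3 $\partial_H(x+y)=\partial_H(x)+\partial_H(y)$; D4 $\partial_H(x\cdot y)=\partial_H(x)\cdot\partial_H(y)$. - pA1 $x\boxplus_\pi y=y\boxplus_{1-\pi}x$;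 pA2 $(x\boxplus_\pi y)\boxplus_\rho z=x\boxplus_{\pi\rho}(y\boxplus_{(1-\pi)\rho/(1-\pi\rho)}z)$; pA3 $x\boxplus_\pi x=x$; pA4 $(x\boxplus_\pi y)\cdot z=x\cdot z\boxplus_\pi y\cdot z$; pA5 $(x\boxplus_\pi y)+z=(x+z)\boxplus_\pi(y+z)$; pA6 $x\boxplus_1y=x$. - CM1′ $x=x+x\wedge y=y+y\Rightarrow x\parallel y=x⌊y+y⌊x+x\mid y$; CM2 $a⌊x=a\cdot x$; CM3 $a\cdot x⌊y=a\cdot(x\parallel y)$; CM4 $(x+y)⌊z=x⌊z+y⌊z$; CM5 $a\cdot x\mid b=\gamma(a,b)\cdot x$; CM6 $a\mid b\cdot x=\gamma(a,b)\cdot x$; CM7 $a\cdot x\mid b\cdot y=\gamma(a,b)\cdot(x\parallel y)$; CM8 $(x+y)\mid z=x\mid z+y\mid z$; CM9 $x\mid(y+z)=x\mid y+x\mid z$; CM10 $\delta\mid x=\delta$; CM11 $x\mid\delta=\delta$; CM12 $a\mid b=\gamma(a,b)$. - pCM1–pCM6: for each $\diamond\in\{\parallel,⌊,\mid\}$, $(x\boxplus_\pi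 y)\diamond z=(x\diamond z)\boxplus_\pi(y\diamond z)$ and $x\diamond(y\boxplus_\pi z)=(x\diamond y)\boxplus_\pi(x\diamond z)$; pD $\partial_H(x\boxplus_\pi y)=\partial_H(x)\boxplus_\pi\partial_H(y)$. *Operational semantics.* On closed terms, relations $x\xrightarrow{a}\surd$ and $x\xrightarrow{a}x'$ ($a\in A$) and $x\overset{\pi}{\leadsto}x'$ ($\pi\in\mathcal P$) are given by the following rules ($a,b\in A$; rules that mention $\gamma(a,b)$ require $\gamma(a,b)\in A$). Probabilistic steps: - $a\overset{1}{\leadsto}a$ and $\delta\overset{1}{\leadsto}\delta$. - If $x\overset{\pi}{\leadsto}x'$ and $y\overset{\rho}{\leadsto}y'$, then $x\diamond y\overset{\pi\rho}{\leadsto}x'\diamond y'$, for $\diamond\in\{+,\parallel,⌊,\mid\}$. - If $x\overset{\pi}{\leadsto}x'$, then $x\cdot y\overset{\pi}{\leadsto}x'\cdot y$ and $\partial_H(x)\overset{\pi}{\leadsto}\partial_H(x')$. - If $x\overset{\rho}{\leadsto}z$ and $y\overset{\rho'}{\leadsto}z$, then $x\boxplus_\pi y\overset{\pi\rho+(1-\pi)\rho'}{\leadsto}z$.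 - If $x\overset{\pi}{\leadsto}x'$ holds for no $\pi\in\mathcal P\setminus\{0\}$, then $x\overset{0}{\leadsto}x'$. (These rules are stratified by the structure of the source term.) Action steps: - $a\xrightarrow{a}\surd$. - If $x\xrightarrow{a}\surd$ and $y\overset1\leadsto y'$, then $x+y\xrightarrow{a}\surd$ and $x\parallel y\xrightarrow{a}y$. If $x\overset1\leadsto x'$ and $y\xrightarrow{a}\surd$, then $x+y\xrightarrow{a}\surd$ and $x\parallel y\xrightarrow{a}x$. - If $x\xrightarrow{a}x'$ and $y\overset1\leadsto y'$, then $x+y\xrightarrow{a}x'$ and $x\parallel y\xrightarrow{a}x'\parallel y$. If $x\overset1\leadsto x'$ and $y\xrightarrow{a}y'$, then $x+y\xrightarrow{a}y'$ and $x\parallel y\xrightarrow{a}x\parallel y'$. - If $x\xrightarrow{a}\surd$, then $x\cdot y\xrightarrow{a}y$ and $x⌊y\xrightarrow{a}y$. If $x\xrightarrow{a}x'$, then $x\cdot y\xrightarrow{a}x'\cdot y$ and $x⌊y\xrightarrow{a}x'\parallel y$. - For $\diamond\in\{\parallel,\mid\}$: if $x\xrightarrow{a}\surd$ and $y\xrightarrow{b}\surd$,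 then $x\diamond y\xrightarrow{\gamma(a,b)}\surd$; if $x\xrightarrow{a}\surd$ and $y\xrightarrow{b}y'$, then $x\diamond y\xrightarrow{\gamma(a,b)}y'$; if $x\xrightarrow{a}x'$ and $y\xrightarrow{b}\surd$, then $x\diamond y\xrightarrow{\gamma(a,b)}x'$; if $x\xrightarrow{a}x'$ and $y\xrightarrow{b}y'$, then $x\diamond y\xrightarrow{\gamma(a,b)}x'\parallel y'$. - For $a\notin H$: if $x\xrightarrow{a}\surd$, then $\partial_H(x)\xrightarrow{a}\surd$; if $x\xrightarrow{a}x'$, then $\partial_H(x)\xrightarrow{a}\partial_H(x')$. *Bisimulation.* Let $P(t,t')$ be the sum of all $\pi$ with $t\overset{\pi}{\leadsto}t'$, and let $P(t,T)=\sum_{t'\in T}P(t,t')$ for a set $T$ of closed terms. A probabilistic bisimulation is an equivalence relation $R$ on closed terms such that $R(t_1,t_2)$ implies: (i) if $t_1\xrightarrow{a}t_1'$, then there is a $t_2'$ with $t_2\xrightarrow{a}t_2'$ and $R(t_1',t_2')$; (ii) if $t_1\xrightarrow{a}\surd$, then $t_2\xrightarrow{a}\surd$; (iii) $P(t_1,[t]_R)=P(t_2,[t]_R)$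 for every closed term $t$, where $[t]_R$ is the $R$-class of $t$. Two closed terms are probabilistic bisimulation equivalent if some probabilistic bisimulation relates them. -/

import Mathlib

universe u v w

/-! ### Signed cancellation meadows and probabilities -/

/-- A signed cancellation meadow: a commutative ring with a total multiplicative inverse and a
signum operation, subject to the meadow axioms, the signum axioms and the cancellation axiom.
The quotient `x / y` abbreviates `x * y⁻¹`. The one-point meadow (`0 = 1`) is not excluded. -/
class SignedCancellationMeadow (M : Type v) extends CommRing M, Inv M where
  /-- the signum operation -/
  sgn : M → M
  inv_inv' : ∀ x : M, (x⁻¹)⁻¹ = x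
  mul_mul_inv' : ∀ x : M, x * (x * x⁻¹) = x
  cancel' : ∀ x y z : M, x ≠ 0 → x * y = x * z → y = z
  sgn_div_self : ∀ x : M, sgn (x * x⁻¹) = x * x⁻¹
  sgn_one_sub_div_self : ∀ x : M, sgn (1 - x * x⁻¹) = 1 - x * x⁻¹
  sgn_neg_one : sgn (-1) = -1
  sgn_inv : ∀ x : M, sgn (x⁻¹) = sgn x
  sgn_mul : ∀ x y : M, sgn (x * y) = sgn x * sgn y
  sgn_add : ∀ x y : M,
    (1 - (sgn x - sgn y) * (sgn x - sgn y)⁻¹) * (sgn (x + y) - sgn x) = 0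

namespace SignedCancellationMeadow

variable {M : Type v} [SignedCancellationMeadow M]

/-- `x` is a probability, that is, `0 ≤ x ≤ 1`, expressed by means of the signum operation. -/
def IsProb (x : M) : Prop := sgn (sgn x + 1) * sgn (sgn (1 - x) + 1) = 1

theorem zero_inv : (0 : M)⁻¹ = 0 := by
  have h := mul_mul_inv' ((0 : M)⁻¹)
  rw [inv_inv', mul_zero, mul_zero] at h
  exact h.symm

theorem mul_inv_self {x : M} (hx : x ≠ 0) : x * x⁻¹ = 1 := by
  apply cancel' x _ _ hx
  rw [mul_mul_inv', mul_one]

theorem sgn_zero : sgn (0 : M) = 0 := by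
  have h := sgn_div_self (0 : M)
  rwa [zero_mul] at h

theorem sgn_one : sgn (1 : M) = 1 := by
  have h := sgn_one_sub_div_self (0 : M)
  rwa [zero_mul, sub_zero] at h

theorem sgn_add_of_eq {x y : M} (h : sgn x = sgn y) : sgn (x + y) = sgn x := by
  have h1 := sgn_add x y
  rw [h, sub_self, zero_mul, sub_zero, one_mul] at h1
  rw [h]
  exact sub_eq_zero.mp h1

theorem sgn_cases (x : M) : x = 0 ∨ sgn x = 1 ∨ sgn x = -1 := by
  by_cases hx : x = 0
  · exact Or.inl hx
  right
  have h : sgn x * sgn x = 1 := by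
    calc sgn x * sgn x = sgn x * sgn (x⁻¹) := by rw [sgn_inv]
      _ = 1 := by rw [← sgn_mul, mul_inv_self hx, sgn_one]
  by_cases h1 : sgn x - 1 = 0
  · exact Or.inl (sub_eq_zero.mp h1)
  · right
    have h2 : sgn x + 1 = 0 := by
      apply cancel' _ _ _ h1
      linear_combination h
    exact eq_neg_of_add_eq_zero_left h2

/-- Auxiliary: `x` is not negative. -/
def NonNeg (x : M) : Prop := x = 0 ∨ sgn x = 1

theorem isProb_iff (h01 : (0 : M) ≠ 1) (x : M) : IsProb x ↔ NonNeg x ∧ NonNeg (1 - x) := by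
  have h2 : sgn ((1 : M) + 1) = 1 := by rw [sgn_add_of_eq rfl, sgn_one]
  have h11 : (1 : M) ≠ -1 := by
    intro h
    have h3 : (1 : M) + 1 = 0 := by linear_combination h
    rw [h3, sgn_zero] at h2
    exact h01 h2
  have key : ∀ y : M,
      (NonNeg y ∧ sgn (sgn y + 1) = 1) ∨ (¬ NonNeg y ∧ sgn (sgn y + 1) = 0) := by
    intro y
    rcases sgn_cases y with h | h | h
    · left
      exact ⟨Or.inl h, by rw [h, sgn_zero, zero_add, sgn_one]⟩
    · left
      exact ⟨Or.inr h, by rw [h, h2]⟩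
    · right
      refine ⟨?_, by rw [h, neg_add_cancel, sgn_zero]⟩
      rintro (h0 | h1)
      · rw [h0, sgn_zero] at h
        exact h01 (by linear_combination -h)
      · exact h11 (h1.symm.trans h)
  unfold IsProb
  rcases key x with ⟨a, b⟩ | ⟨a, b⟩ <;> rcases key (1 - x) with ⟨c, d⟩ | ⟨c, d⟩ <;>
    simp [a, b, c, d, h01]

theorem NonNeg.mul {x y : M} (hx : NonNeg x) (hy : NonNeg y) : NonNeg (x * y) := by
  rcases hx with h | h
  · exact Or.inl (by rw [h, zero_mul])
  rcases hy with h' | h'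
  · exact Or.inl (by rw [h', mul_zero])
  · exact Or.inr (by rw [sgn_mul, h, h', one_mul])

theorem NonNeg.add {x y : M} (hx : NonNeg x) (hy : NonNeg y) : NonNeg (x + y) := by
  rcases hx with h | h
  · rwa [h, zero_add]
  rcases hy with h' | h'
  · rw [h', add_zero]
    exact Or.inr h
  · exact Or.inr (by rw [sgn_add_of_eq (h.trans h'.symm), h])

theorem NonNeg.inv {x : M} (hx : NonNeg x) : NonNeg (x⁻¹) := by
  rcases hx with h | h
  · exact Or.inl (by rw [h, zero_inv])
  · exact Or.inr (by rw [sgn_inv, h])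

theorem isProb_of_nonNeg {x : M} (h : (0 : M) ≠ 1 → NonNeg x ∧ NonNeg (1 - x)) :
    IsProb x := by
  by_cases h01 : (0 : M) = 1
  · have : Subsingleton M := subsingleton_of_zero_eq_one h01
    exact Subsingleton.elim _ _
  · exact (isProb_iff h01 x).mpr (h h01)

theorem isProb_zero : IsProb (0 : M) :=
  isProb_of_nonNeg fun _ => ⟨Or.inl rfl, Or.inr (by rw [sub_zero, sgn_one])⟩

theorem isProb_one : IsProb (1 : M) :=
  isProb_of_nonNeg fun _ => ⟨Or.inr sgn_one, Or.inl (sub_self 1)⟩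

theorem IsProb.compl {x : M} (hx : IsProb x) : IsProb (1 - x) :=
  isProb_of_nonNeg fun h01 => by
    obtain ⟨h, h'⟩ := (isProb_iff h01 x).mp hx
    exact ⟨h', by rwa [sub_sub_cancel]⟩

theorem IsProb.mix {x y z : M} (hx : IsProb x) (hy : IsProb y) (hz : IsProb z) :
    IsProb (x * y + (1 - x) * z) :=
  isProb_of_nonNeg fun h01 => by
    obtain ⟨h1, h1'⟩ := (isProb_iff h01 x).mp hx
    obtain ⟨h2, h2'⟩ := (isProb_iff h01 y).mp hy
    obtain ⟨h3, h3'⟩ := (isProb_iff h01 z).mp hz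
    refine ⟨(h1.mul h2).add (h1'.mul h3), ?_⟩
    have e : 1 - (x * y + (1 - x) * z) = x * (1 - y) + (1 - x) * (1 - z) := by ring
    rw [e]
    exact (h1.mul h2').add (h1'.mul h3')

theorem IsProb.mul {x y : M} (hx : IsProb x) (hy : IsProb y) : IsProb (x * y) := by
  have h := hx.mix hy isProb_zero
  rwa [mul_zero, add_zero] at h

theorem IsProb.rest {x y : M} (hx : IsProb x) (hy : IsProb y) :
    IsProb (((1 - x) * y) * (1 - x * y)⁻¹) :=
  isProb_of_nonNeg fun h01 => by
    obtain ⟨_, h1'⟩ := (isProb_iff h01 x).mp hx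
    obtain ⟨h2, h2'⟩ := (isProb_iff h01 y).mp hy
    have h3 := ((isProb_iff h01 _).mp (hx.mul hy)).2
    refine ⟨(h1'.mul h2).mul h3.inv, ?_⟩
    by_cases h0 : 1 - x * y = 0
    · rw [h0, zero_inv, mul_zero, sub_zero]
      exact Or.inr sgn_one
    · have e : 1 - ((1 - x) * y) * (1 - x * y)⁻¹ = (1 - y) * (1 - x * y)⁻¹ := by
        linear_combination -(mul_inv_self h0)
      rw [e]
      exact h2'.mul h3.inv

end SignedCancellationMeadow

namespace PACP

open SignedCancellationMeadow

/-- The set of probabilities of a signed cancellation meadow. -/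
def Prob (M : Type v) [SignedCancellationMeadow M] : Type v := {x : M // IsProb x}

namespace Prob

variable {M : Type v} [SignedCancellationMeadow M]

/-- The probability `0`. -/
instance : Zero (Prob M) := ⟨⟨0, isProb_zero⟩⟩

/-- The probability `1`. -/
instance : One (Prob M) := ⟨⟨1, isProb_one⟩⟩

/-- The probability `π * ρ`. -/
instance : Mul (Prob M) := ⟨fun π ρ => ⟨π.1 * ρ.1, π.2.mul ρ.2⟩⟩

/-- The probability `1 - π`. -/
def compl (π : Prob M) : Prob M := ⟨1 - π.1, π.2.compl⟩

/-- The probability `((1 - π) * ρ) / (1 - π * ρ)`. -/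
def rest (π ρ : Prob M) : Prob M := ⟨((1 - π.1) * ρ.1) * (1 - π.1 * ρ.1)⁻¹, π.2.rest ρ.2⟩

/-- The probability `π * ρ + (1 - π) * ρ'`. -/
def mix (π ρ ρ' : Prob M) : Prob M := ⟨π.1 * ρ.1 + (1 - π.1) * ρ'.1, π.2.mix ρ.2 ρ'.2⟩

end Prob

/-! ### Terms -/

/-- Terms of pACP over the set of actions `Act` and the meadow `M`, with variables from `V`. -/
inductive Term (Act : Type u) (M : Type v) [SignedCancellationMeadow M] (V : Type w) :
    Type (max u v w) where
  /-- variable -/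
  | var (X : V) : Term Act M V
  /-- action constant -/
  | act (a : Act) : Term Act M V
  /-- inaction constant -/
  | dead : Term Act M V
  /-- alternative composition -/
  | alt (x y : Term Act M V) : Term Act M V
  /-- sequential composition -/
  | seq (x y : Term Act M V) : Term Act M V
  /-- probabilistic choice: `palt π x y` is `x` with probability `π`, `y` with `1 - π` -/
  | palt (π : Prob M) (x y : Term Act M V) : Term Act M V
  /-- parallel composition -/
  | par (x y : Term Act M V) : Term Act M V
  /-- left merge -/
  | lmerge (x y : Term Act M V) : Term Act M V
  /-- communication merge -/
  | cmerge (x y : Term Act M V) : Term Act M V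
  /-- encapsulation -/
  | encap (H : Set Act) (x : Term Act M V) : Term Act M V

/-- Closed terms: terms without variables. -/
abbrev ClosedTerm (Act : Type u) (M : Type v) [SignedCancellationMeadow M] : Type (max u v) :=
  Term Act M Empty

namespace Term

variable {Act : Type u} {M : Type v} [SignedCancellationMeadow M] {V : Type w}

/-- The constants of pACP. An element of `Option Act` stands for an action or, if it is `none`,
for inaction. -/
def const : Option Act → Term Act M V
  | none => dead
  | some a => act a

/-- A closed term, regarded as a term in which variables from `V` may occur. -/
def ofClosed (V : Type w) : ClosedTerm Act M → Term Act M V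
  | var X => X.elim
  | act a => act a
  | dead => dead
  | alt x y => alt (ofClosed V x) (ofClosed V y)
  | seq x y => seq (ofClosed V x) (ofClosed V y)
  | palt π x y => palt π (ofClosed V x) (ofClosed V y)
  | par x y => par (ofClosed V x) (ofClosed V y)
  | lmerge x y => lmerge (ofClosed V x) (ofClosed V y)
  | cmerge x y => cmerge (ofClosed V x) (ofClosed V y)
  | encap H x => encap H (ofClosed V x)

end Term

/-! ### Derivability -/

open Term in
/-- `Derivable γ s t`: the equation `s = t` is derivable from the axioms of pACP with
communication function `γ` in conditional equational logic. Every axiom is given with all its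
substitution instances. The constants `a` and `b` range over actions and inaction. -/
inductive Derivable {Act : Type u} {M : Type v} [SignedCancellationMeadow M] {V : Type w}
    (γ : Option Act → Option Act → Option Act) : Term Act M V → Term Act M V → Prop where
  -- equational logic
  | refl (x) : Derivable γ x x
  | symm {x y} : Derivable γ x y → Derivable γ y x
  | trans {x y z} : Derivable γ x y → Derivable γ y z → Derivable γ x z
  | congr_alt {x x' y y'} : Derivable γ x x' → Derivable γ y y' →
      Derivable γ (alt x y) (alt x' y')
  | congr_seq {x x' y y'} : Derivable γ x x' → Derivable γ y y' →
      Derivable γ (seq x y) (seq x' y')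
  | congr_palt (π) {x x' y y'} : Derivable γ x x' → Derivable γ y y' →
      Derivable γ (palt π x y) (palt π x' y')
  | congr_par {x x' y y'} : Derivable γ x x' → Derivable γ y y' →
      Derivable γ (par x y) (par x' y')
  | congr_lmerge {x x' y y'} : Derivable γ x x' → Derivable γ y y' →
      Derivable γ (lmerge x y) (lmerge x' y')
  | congr_cmerge {x x' y y'} : Derivable γ x x' → Derivable γ y y' →
      Derivable γ (cmerge x y) (cmerge x' y')
  | congr_encap (H) {x x'} : Derivable γ x x' → Derivable γ (encap H x) (encap H x')
  -- alternative and sequential composition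
  | A1 (x y) : Derivable γ (alt x y) (alt y x)
  | A2 (x y z) : Derivable γ (alt (alt x y) z) (alt x (alt y z))
  | A3' (a : Option Act) : Derivable γ (alt (const a) (const a)) (const a)
  | A4 (x y z) : Derivable γ (seq (alt x y) z) (alt (seq x z) (seq y z))
  | A5 (x y z) : Derivable γ (seq (seq x y) z) (seq x (seq y z))
  | A6 (x) : Derivable γ (alt x dead) x
  | A7 (x) : Derivable γ (seq dead x) dead
  -- encapsulation
  | D1 (a : Option Act) (H : Set Act) : a ∉ some '' H →
      Derivable γ (encap H (const a)) (const a)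
  | D2 (a : Option Act) (H : Set Act) : a ∈ some '' H →
      Derivable γ (encap H (const a)) dead
  | D3 (H) (x y) : Derivable γ (encap H (alt x y)) (alt (encap H x) (encap H y))
  | D4 (H) (x y) : Derivable γ (encap H (seq x y)) (seq (encap H x) (encap H y))
  -- probabilistic choice
  | pA1 (π : Prob M) (x y) : Derivable γ (palt π x y) (palt π.compl y x)
  | pA2 (π ρ : Prob M) (x y z) :
      Derivable γ (palt ρ (palt π x y) z) (palt (π * ρ) x (palt (Prob.rest π ρ) y z))
  | pA3 (π : Prob M) (x) : Derivable γ (palt π x x) x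
  | pA4 (π : Prob M) (x y z) : Derivable γ (seq (palt π x y) z) (palt π (seq x z) (seq y z))
  | pA5 (π : Prob M) (x y z) : Derivable γ (alt (palt π x y) z) (palt π (alt x z) (alt y z))
  | pA6 (x y) : Derivable γ (palt 1 x y) x
  -- parallel composition, left merge and communication merge
  | CM1' {x y} : Derivable γ x (alt x x) → Derivable γ y (alt y y) →
      Derivable γ (par x y) (alt (lmerge x y) (alt (lmerge y x) (cmerge x y)))
  | CM2 (a : Option Act) (x) : Derivable γ (lmerge (const a) x) (seq (const a) x)
  | CM3 (a : Option Act) (x y) :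
      Derivable γ (lmerge (seq (const a) x) y) (seq (const a) (par x y))
  | CM4 (x y z) : Derivable γ (lmerge (alt x y) z) (alt (lmerge x z) (lmerge y z))
  | CM5 (a b : Option Act) (x) :
      Derivable γ (cmerge (seq (const a) x) (const b)) (seq (const (γ a b)) x)
  | CM6 (a b : Option Act) (x) :
      Derivable γ (cmerge (const a) (seq (const b) x)) (seq (const (γ a b)) x)
  | CM7 (a b : Option Act) (x y) :
      Derivable γ (cmerge (seq (const a) x) (seq (const b) y)) (seq (const (γ a b)) (par x y))
  | CM8 (x y z) : Derivable γ (cmerge (alt x y) z) (alt (cmerge x z) (cmerge y z))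
  | CM9 (x y z) : Derivable γ (cmerge x (alt y z)) (alt (cmerge x y) (cmerge x z))
  | CM10 (x) : Derivable γ (cmerge dead x) dead
  | CM11 (x) : Derivable γ (cmerge x dead) dead
  | CM12 (a b : Option Act) : Derivable γ (cmerge (const a) (const b)) (const (γ a b))
  | pCM1 (π : Prob M) (x y z) : Derivable γ (par (palt π x y) z) (palt π (par x z) (par y z))
  | pCM2 (π : Prob M) (x y z) : Derivable γ (par x (palt π y z)) (palt π (par x y) (par x z))
  | pCM3 (π : Prob M) (x y z) :
      Derivable γ (lmerge (palt π x y) z) (palt π (lmerge x z) (lmerge y z))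
  | pCM4 (π : Prob M) (x y z) :
      Derivable γ (lmerge x (palt π y z)) (palt π (lmerge x y) (lmerge x z))
  | pCM5 (π : Prob M) (x y z) :
      Derivable γ (cmerge (palt π x y) z) (palt π (cmerge x z) (cmerge y z))
  | pCM6 (π : Prob M) (x y z) :
      Derivable γ (cmerge x (palt π y z)) (palt π (cmerge x y) (cmerge x z))
  | pD (π : Prob M) (H) (x y) :
      Derivable γ (encap H (palt π x y)) (palt π (encap H x) (encap H y))

/-! ### Structural operational semantics -/

section Semantics

open Term

variable {Act : Type u} {M : Type v} [SignedCancellationMeadow M]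

/-- `S π t'` says that a fixed term `t` has a probabilistic step with label `π` to `t'` by one of
the rules without negative premises. The relation is extended by the rule with a negative premise:
if `t` has no step to `t'` with a label other than `0`, then it has such a step with label `0`. -/
def addZeroSteps (S : Prob M → ClosedTerm Act M → Prop) (π : Prob M) (t' : ClosedTerm Act M) :
    Prop :=
  S π t' ∨ (π = 0 ∧ ∀ ρ : Prob M, ρ ≠ 0 → ¬ S ρ t')

/-- `PStep t π t'`: `t` will behave as `t'` with probability `π`. The rules are stratified by the
structure of the source term (the rules without negative premises have premises about proper
subterms of the source only, and the rule with a negative premise yields the label `0` only), so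
that the relation they determine is obtained by recursion on the source term. -/
def PStep : ClosedTerm Act M → Prob M → ClosedTerm Act M → Prop
  | var X => X.elim
  | act a => addZeroSteps fun π t' => π = 1 ∧ t' = act a
  | dead => addZeroSteps fun π t' => π = 1 ∧ t' = dead
  | alt x y => addZeroSteps fun σ t' =>
      ∃ π x' ρ y', PStep x π x' ∧ PStep y ρ y' ∧ σ = π * ρ ∧ t' = alt x' y'
  | seq x y => addZeroSteps fun σ t' => ∃ x', PStep x σ x' ∧ t' = seq x' y
  | palt π x y => addZeroSteps fun σ z =>
      ∃ ρ ρ', PStep x ρ z ∧ PStep y ρ' z ∧ σ = Prob.mix π ρ ρ'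
  | par x y => addZeroSteps fun σ t' =>
      ∃ π x' ρ y', PStep x π x' ∧ PStep y ρ y' ∧ σ = π * ρ ∧ t' = par x' y'
  | lmerge x y => addZeroSteps fun σ t' =>
      ∃ π x' ρ y', PStep x π x' ∧ PStep y ρ y' ∧ σ = π * ρ ∧ t' = lmerge x' y'
  | cmerge x y => addZeroSteps fun σ t' =>
      ∃ π x' ρ y', PStep x π x' ∧ PStep y ρ y' ∧ σ = π * ρ ∧ t' = cmerge x' y'
  | encap H x => addZeroSteps fun σ t' => ∃ x', PStep x σ x' ∧ t' = encap H x'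

/-- `ATerm γ t a`: `t` can perform action `a` and then terminate successfully. -/
inductive ATerm (γ : Option Act → Option Act → Option Act) : ClosedTerm Act M → Act → Prop where
  | act (a) : ATerm γ (act a) a
  | alt_left {x y y' a} : ATerm γ x a → PStep y 1 y' → ATerm γ (alt x y) a
  | alt_right {x x' y a} : PStep x 1 x' → ATerm γ y a → ATerm γ (alt x y) a
  | par {x y a b c} : ATerm γ x a → ATerm γ y b → γ (some a) (some b) = some c →
      ATerm γ (par x y) c
  | cmerge {x y a b c} : ATerm γ x a → ATerm γ y b → γ (some a) (some b) = some c →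
      ATerm γ (cmerge x y) c
  | encap {H : Set Act} {x a} : ATerm γ x a → a ∉ H → ATerm γ (encap H x) a

/-- `AStep γ t a t'`: `t` can perform action `a` and then behave as `t'`. -/
inductive AStep (γ : Option Act → Option Act → Option Act) :
    ClosedTerm Act M → Act → ClosedTerm Act M → Prop where
  | alt_left {x x' y y' a} : AStep γ x a x' → PStep y 1 y' → AStep γ (alt x y) a x'
  | alt_right {x x' y y' a} : PStep x 1 x' → AStep γ y a y' → AStep γ (alt x y) a y'
  | seq_term {x y a} : ATerm γ x a → AStep γ (seq x y) a y
  | seq_step {x x' y a} : AStep γ x a x' → AStep γ (seq x y) a (seq x' y)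
  | par_term_left {x y y' a} : ATerm γ x a → PStep y 1 y' → AStep γ (par x y) a y
  | par_term_right {x x' y a} : PStep x 1 x' → ATerm γ y a → AStep γ (par x y) a x
  | par_step_left {x x' y y' a} : AStep γ x a x' → PStep y 1 y' →
      AStep γ (par x y) a (par x' y)
  | par_step_right {x x' y y' a} : PStep x 1 x' → AStep γ y a y' →
      AStep γ (par x y) a (par x y')
  | par_term_step {x y y' a b c} : ATerm γ x a → AStep γ y b y' →
      γ (some a) (some b) = some c → AStep γ (par x y) c y'
  | par_step_term {x x' y a b c} : AStep γ x a x' → ATerm γ y b →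
      γ (some a) (some b) = some c → AStep γ (par x y) c x'
  | par_step_step {x x' y y' a b c} : AStep γ x a x' → AStep γ y b y' →
      γ (some a) (some b) = some c → AStep γ (par x y) c (par x' y')
  | lmerge_term {x y a} : ATerm γ x a → AStep γ (lmerge x y) a y
  | lmerge_step {x x' y a} : AStep γ x a x' → AStep γ (lmerge x y) a (par x' y)
  | cmerge_term_step {x y y' a b c} : ATerm γ x a → AStep γ y b y' →
      γ (some a) (some b) = some c → AStep γ (cmerge x y) c y'
  | cmerge_step_term {x x' y a b c} : AStep γ x a x' → ATerm γ y b →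
      γ (some a) (some b) = some c → AStep γ (cmerge x y) c x'
  | cmerge_step_step {x x' y y' a b c} : AStep γ x a x' → AStep γ y b y' →
      γ (some a) (some b) = some c → AStep γ (cmerge x y) c (par x' y')
  | encap {H : Set Act} {x x' a} : AStep γ x a x' → a ∉ H → AStep γ (encap H x) a (encap H x')

/-! ### Probabilistic bisimulation -/

/-- `P(t, t')`, the total probability that `t` will behave as `t'`: the sum of all `π` such that
`t` will behave as `t'` with probability `π`. (There is at most one such `π` other than `0`.) -/
noncomputable def prob (t t' : ClosedTerm Act M) : M :=
  ∑ᶠ (π : Prob M) (_ : PStep t π t'), π.1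

/-- `P(t, T)`, the sum of `P(t, t')` over all `t' ∈ T`. (Only finitely many summands are not
zero.) -/
noncomputable def probSet (t : ClosedTerm Act M) (T : Set (ClosedTerm Act M)) : M :=
  ∑ᶠ (t' : ClosedTerm Act M) (_ : t' ∈ T), prob t t'

/-- A probabilistic bisimulation: an equivalence relation on closed terms with the three transfer
properties. The equivalence class of `t` is `{t' | R t t'}`. -/
structure IsProbBisim (γ : Option Act → Option Act → Option Act)
    (R : ClosedTerm Act M → ClosedTerm Act M → Prop) : Prop where
  equivalence : Equivalence R
  step : ∀ t₁ t₂, R t₁ t₂ → ∀ a t₁', AStep γ t₁ a t₁' → ∃ t₂', AStep γ t₂ a t₂' ∧ R t₁' t₂'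
  term : ∀ t₁ t₂, R t₁ t₂ → ∀ a, ATerm γ t₁ a → ATerm γ t₂ a
  prob : ∀ t₁ t₂, R t₁ t₂ → ∀ t, probSet t₁ {t' | R t t'} = probSet t₂ {t' | R t t'}

/-- Probabilistic bisimulation equivalence. -/
def Bisimilar (γ : Option Act → Option Act → Option Act) (t₁ t₂ : ClosedTerm Act M) : Prop :=
  ∃ R : ClosedTerm Act M → ClosedTerm Act M → Prop, IsProbBisim γ R ∧ R t₁ t₂

end Semantics

end PACP

/-! A closed term first resolves its probabilistic choices and then acts, and the proof separates
the two stages.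

Probabilistic stage. By pA1, pA2, pA3 and pA6, closed terms modulo derivability form a convex
algebra. Rearranging mixtures by pA2 is awkward, so the algebra is embedded into its cone, a module
over the semiring of nonnegative elements, where `mix` becomes addition of weighted elements. The
embedding is injective (`Cone.of_injective`), so an equation between mixtures may be proved as an
identity of linear combinations. Since nearly all operations are affine in their arguments (pA4,
pA5, pCM1–pCM6, pD), every closed term equals the combination of its resolved behaviours weighted by
`dist` (`linearCombination_dist`), and `dist` gives exactly the operational probabilities
(`prob_eq_dist`).

Action stage. A resolved term is derivably the sum of its `summands` (`Resolved.cls_eq_sumCls`).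
Resolved terms are idempotent for `alt`, which is what CM1' requires. The summands match the action
steps, exactly for termination and up to derivable equality for the other steps. The discrepancy
arises because CM1' produces the left merge of `y` with `x`, hence remainders in swapped order, so
commutativity of `par` has to be derived (`par_comm_of_comm`).

The stages are joined in `IsProbBisim.cls_eq` by induction on depth. Related resolved terms have
derivably equal summands, since action steps decrease depth. Hence the class of a resolved term
within the depth bound depends only on its `R`-class. Related terms give the same weight to every
`R`-class, so their linear combinations coincide. -/

/-! ### The cone over a convex algebra -/

namespace SignedCancellationMeadow

variable {M : Type v} [SignedCancellationMeadow M]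

/-- A nontrivial signed cancellation meadow is a field. -/
abbrev toField (h01 : (0 : M) ≠ 1) : Field M where
  exists_pair_ne := ⟨0, 1, h01⟩
  mul_inv_cancel _ := mul_inv_self
  inv_zero := zero_inv
  nnqsmul := _
  qsmul := _

theorem NonNeg.zero : NonNeg (0 : M) := Or.inl rfl

theorem NonNeg.one : NonNeg (1 : M) := Or.inr sgn_one

theorem zero_ne_one_of_ne_zero {a : M} (ha : a ≠ 0) : (0 : M) ≠ 1 := fun h => ha (by
  have := subsingleton_of_zero_eq_one h
  exact Subsingleton.elim _ _)

/-- Two positive elements have the same sign, so their sum has that sign too. This keeps the sum of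
two rays a ray. -/
theorem NonNeg.add_ne_zero {a b : M} (ha : NonNeg a) (hb : NonNeg b) (h : a ≠ 0) :
    a + b ≠ 0 := by
  rcases hb with hb | hb
  · rwa [hb, add_zero]
  · intro h0
    have h1 := sgn_add_of_eq ((ha.resolve_left h).trans hb.symm)
    rw [h0, sgn_zero, ha.resolve_left h] at h1
    exact zero_ne_one_of_ne_zero h h1

theorem mul_ne_zero_of_ne_zero {a b : M} (ha : a ≠ 0) (hb : b ≠ 0) : a * b ≠ 0 := fun h =>
  hb (cancel' a b 0 ha (by rw [h, mul_zero]))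

variable (M) in
/-- The semiring of the elements of a signed cancellation meadow that are not negative. -/
def nonNegSubsemiring : Subsemiring M where
  carrier := {x | NonNeg x}
  mul_mem' := NonNeg.mul
  one_mem' := NonNeg.one
  add_mem' := NonNeg.add
  zero_mem' := NonNeg.zero

end SignedCancellationMeadow

namespace PACP

open SignedCancellationMeadow

variable {M : Type v} [SignedCancellationMeadow M]

/-! ### Probabilities as ratios of weights. -/

namespace Prob

theorem one_sub_frac {a b : M} (h : a + b ≠ 0) : 1 - a * (a + b)⁻¹ = b * (a + b)⁻¹ := by
  linear_combination -(mul_inv_self h)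

/-- The probability `a / (a + b)`. -/
def frac (a b : M) (ha : NonNeg a) (hb : NonNeg b) : Prob M :=
  ⟨a * (a + b)⁻¹, isProb_of_nonNeg fun _ => by
    refine ⟨ha.mul (ha.add hb).inv, ?_⟩
    by_cases h : a + b = 0
    · rw [h, zero_inv, mul_zero, sub_zero]
      exact NonNeg.one
    · rw [one_sub_frac h]
      exact hb.mul (ha.add hb).inv⟩

theorem compl_frac {a b : M} (ha : NonNeg a) (hb : NonNeg b) (h : a + b ≠ 0) :
    (frac a b ha hb).compl = frac b a hb ha :=
  Subtype.ext ((one_sub_frac h).trans (by rw [add_comm]; rfl))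

/-- Together with `rest_frac`, this turns the parameters of pA2 into those of regrouping three
weights `a`, `b`, `c`, so that pA2 becomes associativity of addition in the cone. -/
theorem frac_mul_frac {a b c : M} (ha : NonNeg a) (hb : NonNeg b) (hc : NonNeg c)
    (h : a + b ≠ 0) :
    frac a b ha hb * frac (a + b) c (ha.add hb) hc = frac a (b + c) ha (hb.add hc) := by
  apply Subtype.ext
  change a * (a + b)⁻¹ * ((a + b) * (a + b + c)⁻¹) = a * (a + (b + c))⁻¹
  rw [add_assoc a b c]
  linear_combination (a * (a + (b + c))⁻¹) * mul_inv_self h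

theorem rest_frac {a b c : M} (ha : NonNeg a) (hb : NonNeg b) (hc : NonNeg c)
    (h : a ≠ 0) (h' : b ≠ 0) :
    rest (frac a b ha hb) (frac (a + b) c (ha.add hb) hc) = frac b c hb hc := by
  have hab := ha.add_ne_zero hb h
  have hbc := hb.add_ne_zero hc h'
  have habc := ha.add_ne_zero (hb.add hc) h
  apply Subtype.ext
  change (1 - (frac a b ha hb).1) * (frac (a + b) c (ha.add hb) hc).1 *
    (1 - (frac a b ha hb * frac (a + b) c (ha.add hb) hc).1)⁻¹ = b * (b + c)⁻¹
  rw [frac_mul_frac ha hb hc hab]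
  change (1 - a * (a + b)⁻¹) * ((a + b) * (a + b + c)⁻¹) * (1 - a * (a + (b + c))⁻¹)⁻¹ = _
  rw [one_sub_frac hab, one_sub_frac habc, add_assoc]
  -- The identity is proved in an arbitrary field and then transported along `toField`, whose
  -- operations are those of the meadow.
  have key : ∀ {F : Type v} [Field F] (b s t r : F), s ≠ 0 → t ≠ 0 → r ≠ 0 →
      b * s⁻¹ * (s * t⁻¹) * (r * t⁻¹)⁻¹ = b * r⁻¹ := by
    intro F _ b s t r hs ht hr
    field_simp
  exact @key M (toField (zero_ne_one_of_ne_zero h)) b (a + b) (a + (b + c)) (b + c) hab habc hbc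

theorem frac_mul_left {s a b : M} (hs : NonNeg s) (ha : NonNeg a) (hb : NonNeg b)
    (h : s ≠ 0) (hab : a + b ≠ 0) :
    frac (s * a) (s * b) (hs.mul ha) (hs.mul hb) = frac a b ha hb := by
  apply Subtype.ext
  change s * a * (s * a + s * b)⁻¹ = a * (a + b)⁻¹
  rw [← mul_add]
  have key : ∀ {F : Type v} [Field F] (s a t : F), s ≠ 0 → t ≠ 0 →
      s * a * (s * t)⁻¹ = a * t⁻¹ := by
    intro F _ s a t hs ht
    field_simp
  exact @key M (toField (zero_ne_one_of_ne_zero h)) s a (a + b) h hab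

/-- A probability, regarded as an element that is not negative. -/
def toNonNeg (π : Prob M) : nonNegSubsemiring M :=
  ⟨π.1, by
    by_cases h01 : (0 : M) = 1
    · have := subsingleton_of_zero_eq_one h01
      exact Or.inl (Subsingleton.elim _ _)
    · exact ((isProb_iff h01 _).mp π.2).1⟩

end Prob

/-- A convex algebra: a set with binary probabilistic choice operations. -/
class ConvexAlgebra (M : outParam (Type v)) [SignedCancellationMeadow M] (Q : Type w) where
  /-- probabilistic choice -/
  mix : Prob M → Q → Q → Q
  mix_comm : ∀ π x y, mix π x y = mix π.compl y x
  mix_assoc : ∀ π ρ x y z, mix ρ (mix π x y) z = mix (π * ρ) x (mix (Prob.rest π ρ) y z)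
  mix_self : ∀ π x, mix π x x = x
  mix_one : ∀ x y, mix 1 x y = x

open ConvexAlgebra

/-- The cone over a convex algebra: its elements are zero and the positive multiples of the
elements of the convex algebra. -/
inductive Cone (M : Type v) [SignedCancellationMeadow M] (Q : Type w) : Type (max v w) where
  /-- the apex -/
  | zero : Cone M Q
  /-- the element `q` with weight `a` -/
  | ray (a : M) (ha : NonNeg a) (h0 : a ≠ 0) (q : Q) : Cone M Q

namespace Cone

variable {Q : Type w}

theorem ray_congr {a b : M} {ha : NonNeg a} {hb : NonNeg b} {ha0 : a ≠ 0} {hb0 : b ≠ 0}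
    {q r : Q} (h : a = b) (h' : q = r) : ray a ha ha0 q = ray b hb hb0 r := by
  subst h h'
  rfl

instance : Zero (Cone M Q) := ⟨zero⟩

open Classical in
/-- Multiplication of the elements of the cone by scalars. -/
noncomputable def smul (s : nonNegSubsemiring M) : Cone M Q → Cone M Q
  | zero => zero
  | ray a ha ha0 q =>
      if h : s.1 = 0 then zero
      else ray (s.1 * a) (NonNeg.mul s.2 ha) (mul_ne_zero_of_ne_zero h ha0) q

noncomputable instance : SMul (nonNegSubsemiring M) (Cone M Q) := ⟨smul⟩

theorem smul_zero' (s : nonNegSubsemiring M) : s • (0 : Cone M Q) = 0 := rfl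

theorem smul_ray_of_eq {s : nonNegSubsemiring M} (h : s.1 = 0) {a : M} (ha : NonNeg a)
    (ha0 : a ≠ 0) (q : Q) : s • (ray a ha ha0 q : Cone M Q) = 0 := dif_pos h

theorem smul_ray_of_ne {s : nonNegSubsemiring M} (h : s.1 ≠ 0) {a : M} (ha : NonNeg a)
    (ha0 : a ≠ 0) (q : Q) : s • (ray a ha ha0 q : Cone M Q) =
      ray (s.1 * a) (NonNeg.mul s.2 ha) (mul_ne_zero_of_ne_zero h ha0) q := dif_neg h

variable [ConvexAlgebra M Q]

/-- Addition in the cone: the weights are added, the elements are mixed in proportion. -/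
def add : Cone M Q → Cone M Q → Cone M Q
  | zero, y => y
  | x, zero => x
  | ray a ha ha0 q, ray b hb _ r =>
      ray (a + b) (ha.add hb) (ha.add_ne_zero hb ha0) (mix (Prob.frac a b ha hb) q r)

instance : Add (Cone M Q) := ⟨add⟩

theorem ray_add_ray {a b : M} (ha : NonNeg a) (hb : NonNeg b) (ha0 : a ≠ 0) (hb0 : b ≠ 0)
    (q r : Q) : (ray a ha ha0 q + ray b hb hb0 r : Cone M Q) =
      ray (a + b) (ha.add hb) (ha.add_ne_zero hb ha0) (mix (Prob.frac a b ha hb) q r) := rfl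

theorem zero_add' (x : Cone M Q) : 0 + x = x := by
  cases x <;> rfl

theorem add_zero' (x : Cone M Q) : x + 0 = x := by
  cases x <;> rfl

theorem add_comm' (x y : Cone M Q) : x + y = y + x := by
  rcases x with _ | ⟨a, ha, ha0, q⟩
  · exact (zero_add' y).trans (add_zero' y).symm
  rcases y with _ | ⟨b, hb, hb0, r⟩
  · rfl
  · rw [ray_add_ray, ray_add_ray]
    refine ray_congr (add_comm _ _) ?_
    rw [mix_comm, Prob.compl_frac ha hb (ha.add_ne_zero hb ha0)]

theorem add_assoc' (x y z : Cone M Q) : x + y + z = x + (y + z) := by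
  rcases x with _ | ⟨a, ha, ha0, q⟩
  · exact ((zero_add' (y + z)).trans (congrArg (· + z) (zero_add' y).symm)).symm
  rcases y with _ | ⟨b, hb, hb0, r⟩
  · exact congrArg (_ + ·) (zero_add' z).symm
  rcases z with _ | ⟨c, hc, hc0, s⟩
  · rfl
  · rw [ray_add_ray, ray_add_ray, ray_add_ray, ray_add_ray]
    refine ray_congr (add_assoc _ _ _) ?_
    -- Only nonzero weights occur in rays, which is why the ratio identities may divide freely.
    rw [mix_assoc, Prob.rest_frac ha hb hc ha0 hb0,
      Prob.frac_mul_frac ha hb hc (ha.add_ne_zero hb ha0)]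

instance : AddCommMonoid (Cone M Q) where
  add_assoc := add_assoc'
  zero_add := zero_add'
  add_zero := add_zero'
  add_comm := add_comm'
  nsmul := nsmulRec

/-- Scaling leaves ratios of weights unchanged, which gives `smul_add`; idempotence of `mix` gives
`add_smul`, since it lets two multiples of one element coalesce. -/
noncomputable instance : Module (nonNegSubsemiring M) (Cone M Q) where
  one_smul x := by
    rcases x with _ | ⟨a, ha, ha0, q⟩
    · rfl
    · rw [smul_ray_of_ne (zero_ne_one_of_ne_zero ha0).symm]
      exact ray_congr (one_mul a) rfl
  mul_smul s t x := by
    rcases x with _ | ⟨a, ha, ha0, q⟩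
    · rfl
    by_cases ht : t.1 = 0
    · rw [smul_ray_of_eq ht, smul_zero', smul_ray_of_eq]
      exact (congrArg (s.1 * ·) ht).trans (mul_zero _)
    by_cases hs : s.1 = 0
    · rw [smul_ray_of_ne ht, smul_ray_of_eq hs, smul_ray_of_eq]
      exact (congrArg (· * t.1) hs).trans (zero_mul _)
    · rw [smul_ray_of_ne ht, smul_ray_of_ne hs,
        smul_ray_of_ne (s := s * t) (mul_ne_zero_of_ne_zero hs ht)]
      exact ray_congr (mul_assoc _ _ _) rfl
  smul_zero _ := rfl
  smul_add s x y := by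
    rcases x with _ | ⟨a, ha, ha0, q⟩
    · exact (congrArg (s • ·) (zero_add y)).trans (zero_add _).symm
    rcases y with _ | ⟨b, hb, hb0, r⟩
    · exact (add_zero _).symm
    by_cases hs : s.1 = 0
    · rw [ray_add_ray, smul_ray_of_eq hs, smul_ray_of_eq hs, smul_ray_of_eq hs, add_zero]
    · rw [ray_add_ray, smul_ray_of_ne hs, smul_ray_of_ne hs, smul_ray_of_ne hs, ray_add_ray]
      refine ray_congr (mul_add _ _ _) ?_
      rw [Prob.frac_mul_left s.2 ha hb hs (ha.add_ne_zero hb ha0)]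
  add_smul s t x := by
    rcases x with _ | ⟨a, ha, ha0, q⟩
    · rfl
    by_cases ht : t.1 = 0
    · have : t = 0 := Subtype.ext ht
      rw [smul_ray_of_eq ht, add_zero, this, add_zero]
    by_cases hs : s.1 = 0
    · have : s = 0 := Subtype.ext hs
      rw [smul_ray_of_eq hs, zero_add, this, zero_add]
    · rw [smul_ray_of_ne ht, smul_ray_of_ne hs, ray_add_ray, mix_self,
        smul_ray_of_ne (s := s + t) (NonNeg.add_ne_zero s.2 t.2 hs)]
      exact ray_congr (add_mul _ _ _) rfl
  zero_smul x := by
    rcases x with _ | ⟨a, ha, ha0, q⟩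
    · rfl
    · exact smul_ray_of_eq rfl ha ha0 q

open Classical in
/-- The embedding of a convex algebra into its cone. -/
noncomputable def of (q : Q) : Cone M Q :=
  -- In the one-point meadow there are no nonzero weights, so the cone is only its apex.
  if h : (1 : M) = 0 then 0 else ray 1 NonNeg.one h q

/-- An affine map between convex algebras extends to a linear map between the cones. -/
noncomputable def map (f : Q → Q) (hf : ∀ (π : Prob M) x y, f (mix π x y) = mix π (f x) (f y)) :
    Cone M Q →ₗ[nonNegSubsemiring M] Cone M Q where
  toFun
    | zero => zero
    | ray a ha ha0 q => ray a ha ha0 (f q)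
  map_add' x y := by
    rcases x with _ | ⟨a, ha, ha0, q⟩
    · rcases y with _ | ⟨b, hb, hb0, r⟩ <;> rfl
    rcases y with _ | ⟨b, hb, hb0, r⟩
    · rfl
    · exact ray_congr rfl (hf _ _ _)
  map_smul' s x := by
    rcases x with _ | ⟨a, ha, ha0, q⟩
    · rfl
    by_cases hs : s.1 = 0
    · rw [smul_ray_of_eq hs]
      exact (smul_ray_of_eq hs _ _ _).symm
    · rw [smul_ray_of_ne hs]
      exact (smul_ray_of_ne hs _ _ _).symm

theorem map_of (f : Q → Q) (hf : ∀ (π : Prob M) x y, f (mix π x y) = mix π (f x) (f y)) (q : Q) :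
    map f hf (of q) = of (f q) := by
  unfold of
  split_ifs <;> rfl

theorem mix_zero (x y : Q) : mix (0 : Prob M) x y = y := by
  rw [mix_comm, show (0 : Prob M).compl = 1 from Subtype.ext (sub_zero 1), mix_one]

theorem of_mix (π : Prob M) (x y : Q) :
    (of (mix π x y) : Cone M Q) = π.toNonNeg • of x + π.compl.toNonNeg • of y := by
  by_cases h : (1 : M) = 0
  · have h' : ∀ q : Q, (of q : Cone M Q) = 0 := fun q => dif_pos h
    rw [h', h', h', smul_zero, smul_zero, add_zero]
  have h' : ∀ q : Q, (of q : Cone M Q) = ray 1 NonNeg.one h q := fun q => dif_neg h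
  rw [h', h', h']
  -- The endpoints `0` and `1` are separate because a ray cannot have weight zero; there the
  -- identity rests on `mix_one`.
  by_cases h0 : π.1 = 0
  · obtain rfl : π = 0 := Subtype.ext h0
    have h1 : (1 : M) - 0 ≠ 0 := by rwa [sub_zero]
    rw [smul_ray_of_eq h0, zero_add, mix_zero, smul_ray_of_ne h1]
    exact ray_congr (by rw [mul_one]; exact (sub_zero 1).symm) rfl
  by_cases h1 : 1 - π.1 = 0
  · obtain rfl : π = 1 := Subtype.ext (sub_eq_zero.mp h1).symm
    rw [smul_ray_of_eq (s := Prob.compl 1 |>.toNonNeg) h1, add_zero, mix_one, smul_ray_of_ne h0]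
    exact ray_congr (mul_one _).symm rfl
  · rw [smul_ray_of_ne h0, smul_ray_of_ne h1, ray_add_ray]
    refine ray_congr ?_ ?_
    · change 1 = π.1 * 1 + (1 - π.1) * 1
      ring
    · congr 1
      apply Subtype.ext
      change π.1 = π.1 * 1 * (π.1 * 1 + (1 - π.1) * 1)⁻¹
      have e : π.1 * 1 + (1 - π.1) * 1 = 1 := by ring
      have e1 : (1 : M)⁻¹ = 1 := by simpa using mul_inv_self h
      rw [e, e1, mul_one, mul_one]

/-- A ray of weight one determines its element. In the one-point meadow the probabilities `0` and
`1` coincide, so `mix_one` and `mix_zero` already identify all elements of `Q`. -/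
theorem of_injective : Function.Injective (of : Q → Cone M Q) := by
  intro x y hxy
  by_cases h : (1 : M) = 0
  · rw [← mix_one (M := M) x y, show (1 : Prob M) = 0 from Subtype.ext h, mix_zero]
  · have h' : ∀ q : Q, (of q : Cone M Q) = ray 1 NonNeg.one h q := fun q => dif_neg h
    rw [h', h'] at hxy
    injection hxy

end Cone

end PACP

/-! ### Closed terms modulo derivability -/

namespace PACP

open SignedCancellationMeadow Term ConvexAlgebra

section Algebra

variable {Act : Type u} {M : Type v} [SignedCancellationMeadow M]

theorem Term.ofClosed_const (V : Type w) (a : Option Act) :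
    ofClosed V (const a : ClosedTerm Act M) = const a := by
  cases a <;> rfl

/-- An equation between closed terms that has a derivation in which only closed terms occur is
derivable. -/
theorem Derivable.ofClosed {γ : Option Act → Option Act → Option Act} (V : Type w)
    {s t : ClosedTerm Act M} (h : Derivable γ s t) :
    Derivable γ (Term.ofClosed V s) (Term.ofClosed V t) := by
  induction h with
  | refl x => exact .refl _
  | symm _ ih => exact .symm ih
  | trans _ _ ih ih' => exact .trans ih ih'
  | congr_alt _ _ ih ih' => exact .congr_alt ih ih'
  | congr_seq _ _ ih ih' => exact .congr_seq ih ih'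
  | congr_palt π _ _ ih ih' => exact .congr_palt π ih ih'
  | congr_par _ _ ih ih' => exact .congr_par ih ih'
  | congr_lmerge _ _ ih ih' => exact .congr_lmerge ih ih'
  | congr_cmerge _ _ ih ih' => exact .congr_cmerge ih ih'
  | congr_encap H _ ih => exact .congr_encap H ih
  | CM1' _ _ ih ih' => exact .CM1' ih ih'
  | _ =>
    simp only [Term.ofClosed, Term.ofClosed_const]
    first
      | exact .D1 _ _ ‹_› | exact .D2 _ _ ‹_› | apply Derivable.A1 | apply Derivable.A2
      | apply Derivable.A3' | apply Derivable.A4 | apply Derivable.A5 | apply Derivable.A6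
      | apply Derivable.A7 | apply Derivable.D3 | apply Derivable.D4 | apply Derivable.pA1
      | apply Derivable.pA2 | apply Derivable.pA3 | apply Derivable.pA4 | apply Derivable.pA5
      | apply Derivable.pA6 | apply Derivable.CM2 | apply Derivable.CM3 | apply Derivable.CM4
      | apply Derivable.CM5 | apply Derivable.CM6 | apply Derivable.CM7 | apply Derivable.CM8
      | apply Derivable.CM9 | apply Derivable.CM10 | apply Derivable.CM11 | apply Derivable.CM12
      | apply Derivable.pCM1 | apply Derivable.pCM2 | apply Derivable.pCM3 | apply Derivable.pCM4
      | apply Derivable.pCM5 | apply Derivable.pCM6 | apply Derivable.pD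

/-- Derivability of equations between closed terms as an equivalence relation. -/
def derivSetoid (M : Type v) [SignedCancellationMeadow M]
    (γ : Option Act → Option Act → Option Act) : Setoid (ClosedTerm Act M) where
  r := Derivable γ
  iseqv := ⟨.refl, .symm, .trans⟩

/-- Closed terms modulo derivability. -/
def DClass (M : Type v) [SignedCancellationMeadow M]
    (γ : Option Act → Option Act → Option Act) : Type (max u v) :=
  Quotient (derivSetoid M γ)

variable (γ : Option Act → Option Act → Option Act)

/-- The class of a closed term. -/
def cls (t : ClosedTerm Act M) : DClass M γ := Quotient.mk _ t

variable {γ}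

theorem cls_eq {s t : ClosedTerm Act M} : cls γ s = cls γ t ↔ Derivable γ s t :=
  Quotient.eq (r := derivSetoid M γ)

namespace DClass

theorem ind {p : DClass M γ → Prop} (h : ∀ t, p (cls γ t)) (x : DClass M γ) : p x :=
  Quotient.ind h x

instance : Add (DClass M γ) := ⟨Quotient.map₂ alt fun _ _ hx _ _ hy => .congr_alt hx hy⟩

instance : Zero (DClass M γ) := ⟨cls γ dead⟩

/-- Sequential composition of classes. -/
def seq : DClass M γ → DClass M γ → DClass M γ :=
  Quotient.map₂ Term.seq fun _ _ hx _ _ hy => .congr_seq hx hy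

/-- Parallel composition of classes. -/
def par : DClass M γ → DClass M γ → DClass M γ :=
  Quotient.map₂ Term.par fun _ _ hx _ _ hy => .congr_par hx hy

/-- Left merge of classes. -/
def lmerge : DClass M γ → DClass M γ → DClass M γ :=
  Quotient.map₂ Term.lmerge fun _ _ hx _ _ hy => .congr_lmerge hx hy

/-- Communication merge of classes. -/
def cmerge : DClass M γ → DClass M γ → DClass M γ :=
  Quotient.map₂ Term.cmerge fun _ _ hx _ _ hy => .congr_cmerge hx hy

/-- Encapsulation of classes. -/
def encap (H : Set Act) : DClass M γ → DClass M γ :=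
  Quotient.map (Term.encap H) fun _ _ h => .congr_encap H h

/-- Probabilistic choice between classes. -/
def palt (π : Prob M) : DClass M γ → DClass M γ → DClass M γ :=
  Quotient.map₂ (Term.palt π) fun _ _ hx _ _ hy => .congr_palt π hx hy

instance : ConvexAlgebra M (DClass M γ) where
  mix := palt
  mix_comm π := ind fun x => ind fun y => cls_eq.mpr (.pA1 π x y)
  mix_assoc π ρ := ind fun x => ind fun y => ind fun z => cls_eq.mpr (.pA2 π ρ x y z)
  mix_self π := ind fun x => cls_eq.mpr (.pA3 π x)
  mix_one := ind fun x => ind fun y => cls_eq.mpr (.pA6 x y)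

theorem add_comm' : ∀ x y : DClass M γ, x + y = y + x :=
  ind fun x => ind fun y => cls_eq.mpr (.A1 x y)

theorem add_zero' : ∀ x : DClass M γ, x + 0 = x := ind fun x => cls_eq.mpr (.A6 x)

instance : AddCommMonoid (DClass M γ) where
  add_assoc := ind fun x => ind fun y => ind fun z => cls_eq.mpr (.A2 x y z)
  zero_add x := (add_comm' 0 x).trans (add_zero' x)
  add_zero := add_zero'
  add_comm := add_comm'
  nsmul := nsmulRec

theorem seq_add : ∀ x y z : DClass M γ, seq (x + y) z = seq x z + seq y z :=
  ind fun x => ind fun y => ind fun z => cls_eq.mpr (.A4 x y z)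

theorem zero_seq : ∀ x : DClass M γ, seq 0 x = 0 := ind fun x => cls_eq.mpr (.A7 x)

theorem seq_assoc : ∀ x y z : DClass M γ, seq (seq x y) z = seq x (seq y z) :=
  ind fun x => ind fun y => ind fun z => cls_eq.mpr (.A5 x y z)

theorem lmerge_add : ∀ x y z : DClass M γ, lmerge (x + y) z = lmerge x z + lmerge y z :=
  ind fun x => ind fun y => ind fun z => cls_eq.mpr (.CM4 x y z)

/-- CM2 is available for inaction as well, and A7 then removes what follows it. -/
theorem zero_lmerge : ∀ x : DClass M γ, lmerge 0 x = 0 :=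
  ind fun x => (cls_eq.mpr (.CM2 none x)).trans (cls_eq.mpr (.A7 x))

theorem add_cmerge : ∀ x y z : DClass M γ, cmerge (x + y) z = cmerge x z + cmerge y z :=
  ind fun x => ind fun y => ind fun z => cls_eq.mpr (.CM8 x y z)

theorem cmerge_add : ∀ x y z : DClass M γ, cmerge x (y + z) = cmerge x y + cmerge x z :=
  ind fun x => ind fun y => ind fun z => cls_eq.mpr (.CM9 x y z)

theorem zero_cmerge : ∀ x : DClass M γ, cmerge 0 x = 0 := ind fun x => cls_eq.mpr (.CM10 x)

theorem cmerge_zero : ∀ x : DClass M γ, cmerge x 0 = 0 := ind fun x => cls_eq.mpr (.CM11 x)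

theorem encap_add (H : Set Act) : ∀ x y : DClass M γ, encap H (x + y) = encap H x + encap H y :=
  ind fun x => ind fun y => cls_eq.mpr (.D3 H x y)

theorem encap_zero (H : Set Act) : encap H (0 : DClass M γ) = 0 :=
  cls_eq.mpr (.D1 none H (by simp))

theorem encap_seq (H : Set Act) :
    ∀ x y : DClass M γ, encap H (seq x y) = seq (encap H x) (encap H y) :=
  ind fun x => ind fun y => cls_eq.mpr (.D4 H x y)

theorem mix_add (π : Prob M) :
    ∀ z x y : DClass M γ, mix π x y + z = mix π (x + z) (y + z) :=
  ind fun z => ind fun x => ind fun y => cls_eq.mpr (.pA5 π x y z)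

theorem add_mix (π : Prob M) (z x y : DClass M γ) :
    z + mix π x y = mix π (z + x) (z + y) := by
  rw [add_comm, mix_add, add_comm x, add_comm y]

theorem mix_seq (π : Prob M) :
    ∀ z x y : DClass M γ, seq (mix π x y) z = mix π (seq x z) (seq y z) :=
  ind fun z => ind fun x => ind fun y => cls_eq.mpr (.pA4 π x y z)

theorem mix_par (π : Prob M) :
    ∀ z x y : DClass M γ, par (mix π x y) z = mix π (par x z) (par y z) :=
  ind fun z => ind fun x => ind fun y => cls_eq.mpr (.pCM1 π x y z)

theorem par_mix (π : Prob M) :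
    ∀ z x y : DClass M γ, par z (mix π x y) = mix π (par z x) (par z y) :=
  ind fun z => ind fun x => ind fun y => cls_eq.mpr (.pCM2 π z x y)

theorem mix_lmerge (π : Prob M) :
    ∀ z x y : DClass M γ, lmerge (mix π x y) z = mix π (lmerge x z) (lmerge y z) :=
  ind fun z => ind fun x => ind fun y => cls_eq.mpr (.pCM3 π x y z)

theorem lmerge_mix (π : Prob M) :
    ∀ z x y : DClass M γ, lmerge z (mix π x y) = mix π (lmerge z x) (lmerge z y) :=
  ind fun z => ind fun x => ind fun y => cls_eq.mpr (.pCM4 π z x y)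

theorem mix_cmerge (π : Prob M) :
    ∀ z x y : DClass M γ, cmerge (mix π x y) z = mix π (cmerge x z) (cmerge y z) :=
  ind fun z => ind fun x => ind fun y => cls_eq.mpr (.pCM5 π x y z)

theorem cmerge_mix (π : Prob M) :
    ∀ z x y : DClass M γ, cmerge z (mix π x y) = mix π (cmerge z x) (cmerge z y) :=
  ind fun z => ind fun x => ind fun y => cls_eq.mpr (.pCM6 π z x y)

theorem encap_mix (H : Set Act) (π : Prob M) :
    ∀ x y : DClass M γ, encap H (mix π x y) = mix π (encap H x) (encap H y) :=
  ind fun x => ind fun y => cls_eq.mpr (.pD π H x y)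

theorem par_eq : ∀ {x y : DClass M γ}, x + x = x → y + y = y →
    par x y = lmerge x y + (lmerge y x + cmerge x y) := by
  intro x y
  induction x using ind with | _ x
  induction y using ind with | _ y
  exact fun hx hy => cls_eq.mpr (.CM1' (cls_eq.mp hx.symm) (cls_eq.mp hy.symm))

/-- The class of a constant. -/
def const (γ : Option Act → Option Act → Option Act) (a : Option Act) : DClass M γ :=
  cls γ (Term.const a)

theorem const_add_const (a : Option Act) : (const γ a + const γ a : DClass M γ) = const γ a :=
  cls_eq.mpr (.A3' a)

theorem const_lmerge (a : Option Act) :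
    ∀ x : DClass M γ, lmerge (const γ a) x = seq (const γ a) x :=
  ind fun x => cls_eq.mpr (.CM2 a x)

theorem const_seq_lmerge (a : Option Act) :
    ∀ x y : DClass M γ, lmerge (seq (const γ a) x) y = seq (const γ a) (par x y) :=
  ind fun x => ind fun y => cls_eq.mpr (.CM3 a x y)

theorem const_seq_cmerge_const (a b : Option Act) : ∀ x : DClass M γ,
    cmerge (seq (const γ a) x) (const γ b) = seq (const γ (γ a b)) x :=
  ind fun x => cls_eq.mpr (.CM5 a b x)

theorem const_cmerge_const_seq (a b : Option Act) : ∀ x : DClass M γ,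
    cmerge (const γ a) (seq (const γ b) x) = seq (const γ (γ a b)) x :=
  ind fun x => cls_eq.mpr (.CM6 a b x)

theorem const_seq_cmerge_const_seq (a b : Option Act) : ∀ x y : DClass M γ,
    cmerge (seq (const γ a) x) (seq (const γ b) y) = seq (const γ (γ a b)) (par x y) :=
  ind fun x => ind fun y => cls_eq.mpr (.CM7 a b x y)

theorem const_cmerge_const (a b : Option Act) :
    (cmerge (const γ a) (const γ b) : DClass M γ) = const γ (γ a b) :=
  cls_eq.mpr (.CM12 a b)

theorem encap_const_of_notMem {H : Set Act} {a : Act} (h : a ∉ H) :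
    encap H (const γ (some a) : DClass M γ) = const γ (some a) :=
  cls_eq.mpr (.D1 (some a) H (by simpa using h))

theorem encap_const_of_mem {H : Set Act} {a : Act} (h : a ∈ H) :
    encap H (const γ (some a) : DClass M γ) = 0 :=
  cls_eq.mpr (.D2 (some a) H (by simpa using h))

end DClass

end Algebra

end PACP

/-! ### Resolved terms and their summands -/

namespace PACP

open SignedCancellationMeadow Term ConvexAlgebra

section Summands

variable {Act : Type u} {M : Type v} [SignedCancellationMeadow M]

/-- A closed term is resolved if it can only behave as itself. -/
inductive Resolved : ClosedTerm Act M → Prop where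
  | act (a) : Resolved (act a)
  | dead : Resolved dead
  | alt {x y} : Resolved x → Resolved y → Resolved (alt x y)
  | seq {x} (y) : Resolved x → Resolved (seq x y)
  | par {x y} : Resolved x → Resolved y → Resolved (par x y)
  | lmerge {x y} : Resolved x → Resolved y → Resolved (lmerge x y)
  | cmerge {x y} : Resolved x → Resolved y → Resolved (cmerge x y)
  | encap (H) {x} : Resolved x → Resolved (encap H x)

/-- An upper bound for the number of actions that a closed term can perform in sequence. -/
def depth : ClosedTerm Act M → ℕ
  | var X => X.elim
  | act _ => 1
  | dead => 0
  | alt x y => max (depth x) (depth y)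
  | seq x y => depth x + depth y
  | palt _ x y => max (depth x) (depth y)
  | par x y => depth x + depth y
  | lmerge x y => depth x + depth y
  | cmerge x y => depth x + depth y
  | encap _ x => depth x

theorem ATerm.depth_pos {γ : Option Act → Option Act → Option Act} {t : ClosedTerm Act M} {a : Act}
    (h : ATerm γ t a) : 0 < depth t := by
  induction h <;> simp only [depth] <;> omega

/-- The measure for the completeness induction. Where one component terminates and disappears, the
decrease comes from `ATerm.depth_pos`. -/
theorem AStep.depth_lt {γ : Option Act → Option Act → Option Act} {s t : ClosedTerm Act M} {a : Act}
    (h : AStep γ t a s) : depth s < depth t := by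
  induction h with
  | seq_term h | par_term_left h | par_term_right _ h | par_term_step h | par_step_term _ h
  | lmerge_term h | cmerge_term_step h | cmerge_step_term _ h =>
    have := h.depth_pos
    simp only [depth]
    omega
  | _ => simp only [depth] at *; omega

/-- A summand of a closed term: an action and what remains to be done after it, if anything. -/
abbrev Summand (Act : Type u) (M : Type v) [SignedCancellationMeadow M] : Type (max u v) :=
  Act × Option (ClosedTerm Act M)

/-- What remains to be done by two processes in parallel. -/
def parRest : Option (ClosedTerm Act M) → Option (ClosedTerm Act M) → Option (ClosedTerm Act M)
  | none, y => y
  | x, none => x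
  | some x, some y => some (par x y)

/-- The summands obtained by letting `y` follow the first action of the summands in `l`,
where `f` says how it is combined with what remains to be done. -/
def followList (f : ClosedTerm Act M → ClosedTerm Act M) (y : ClosedTerm Act M)
    (l : List (Summand Act M)) : List (Summand Act M) :=
  l.map fun p => (p.1, some (p.2.elim y f))

/-- The summand that consists of the synchronization of two summands, if they communicate. -/
def commSummand (γ : Option Act → Option Act → Option Act) (p q : Summand Act M) :
    Option (Summand Act M) :=
  (γ (some p.1) (some q.1)).map fun c => (c, parRest p.2 q.2)

/-- The summands obtained by synchronizing summands in `l` with summands in `l'`. -/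
def commList (γ : Option Act → Option Act → Option Act) (l l' : List (Summand Act M)) :
    List (Summand Act M) :=
  l.flatMap fun p => l'.filterMap (commSummand γ p)

open Classical in
/-- The summand that remains of a summand after encapsulation, if any. -/
noncomputable def encapSummand (H : Set Act) (p : Summand Act M) : Option (Summand Act M) :=
  if p.1 ∈ H then none else some (p.1, p.2.map (encap H))

/-- The summands of a resolved term. -/
noncomputable def summands (γ : Option Act → Option Act → Option Act) :
    ClosedTerm Act M → List (Summand Act M)
  | var X => X.elim
  | act a => [(a, none)]
  | dead => []
  | alt x y => summands γ x ++ summands γ y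
  | seq x y => followList (fun s => seq s y) y (summands γ x)
  -- A default value: `palt` does not occur as the head of a resolved term.
  | palt _ _ _ => []
  | par x y => followList (fun s => par s y) y (summands γ x) ++
      -- The order `par s x` is the one that CM1' and CM3 produce; the operational rule yields `par
      -- x s`.
      (followList (fun s => par s x) x (summands γ y) ++
        commList γ (summands γ x) (summands γ y))
  | lmerge x y => followList (fun s => par s y) y (summands γ x)
  | cmerge x y => commList γ (summands γ x) (summands γ y)
  | encap H x => (summands γ x).filterMap (encapSummand H)

theorem mem_followList {f : ClosedTerm Act M → ClosedTerm Act M} {y : ClosedTerm Act M}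
    {l : List (Summand Act M)} {a : Act} {o : Option (ClosedTerm Act M)} :
    (a, o) ∈ followList f y l ↔
      ((a, none) ∈ l ∧ o = some y) ∨ ∃ s, (a, some s) ∈ l ∧ o = some (f s) := by
  constructor
  · intro h
    obtain ⟨⟨b, _ | s⟩, hp, e⟩ := List.mem_map.mp h
    · obtain ⟨rfl, rfl⟩ := Prod.mk.inj e
      exact Or.inl ⟨hp, rfl⟩
    · obtain ⟨rfl, rfl⟩ := Prod.mk.inj e
      exact Or.inr ⟨s, hp, rfl⟩
  · rintro (⟨h, rfl⟩ | ⟨s, h, rfl⟩)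
    · exact List.mem_map.mpr ⟨_, h, rfl⟩
    · exact List.mem_map.mpr ⟨_, h, rfl⟩

theorem mem_commList {γ : Option Act → Option Act → Option Act} {l l' : List (Summand Act M)}
    {c : Act} {o : Option (ClosedTerm Act M)} :
    (c, o) ∈ commList γ l l' ↔ ∃ p ∈ l, ∃ q ∈ l',
      γ (some p.1) (some q.1) = some c ∧ o = parRest p.2 q.2 := by
  simp only [commList, commSummand, List.mem_flatMap, List.mem_filterMap, Option.map_eq_some_iff,
    Prod.mk.injEq]
  constructor
  · rintro ⟨p, hp, q, hq, c', h, rfl, rfl⟩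
    exact ⟨p, hp, q, hq, h, rfl⟩
  · rintro ⟨p, hp, q, hq, h, rfl⟩
    exact ⟨p, hp, q, hq, c, h, rfl, rfl⟩

theorem mem_encapList {H : Set Act} {l : List (Summand Act M)}
    {a : Act} {o : Option (ClosedTerm Act M)} :
    (a, o) ∈ l.filterMap (encapSummand H) ↔
      a ∉ H ∧ ∃ o', (a, o') ∈ l ∧ o = o'.map (encap H) := by
  simp only [List.mem_filterMap, encapSummand, Option.ite_none_left_eq_some, Option.some.injEq,
    Prod.mk.injEq, Prod.exists]
  constructor
  · rintro ⟨b, o', h, hb, rfl, rfl⟩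
    exact ⟨hb, o', h, rfl⟩
  · rintro ⟨ha, o', h, rfl⟩
    exact ⟨a, o', h, ha, rfl, rfl⟩

/-- The depth of what remains to be done after the action of a summand. -/
def restDepth (o : Option (ClosedTerm Act M)) : ℕ := o.elim 0 depth

theorem restDepth_parRest (o o' : Option (ClosedTerm Act M)) :
    restDepth (parRest o o') = restDepth o + restDepth o' := by
  cases o <;> cases o' <;> simp [restDepth, parRest, depth]

/-- The analogue of `AStep.depth_lt` for summands. It is needed because commutativity of `par` is
proved by induction before summands are linked with action steps. -/
theorem restDepth_lt {γ : Option Act → Option Act → Option Act} :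
    ∀ {t : ClosedTerm Act M} {p : Summand Act M}, p ∈ summands γ t → restDepth p.2 < depth t := by
  have follow : ∀ {x y : ClosedTerm Act M} {f : ClosedTerm Act M → ClosedTerm Act M}
      {p : Summand Act M}, (∀ {p}, p ∈ summands γ x → restDepth p.2 < depth x) →
      (∀ s, depth (f s) = depth s + depth y) → p ∈ followList f y (summands γ x) →
      restDepth p.2 < depth x + depth y := by
    rintro x y f ⟨a, o⟩ ih hf h
    rcases mem_followList.mp h with ⟨h', rfl⟩ | ⟨s, h', rfl⟩ <;> have := ih h' <;>
      simp only [restDepth, Option.elim, hf] at this ⊢ <;> omega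
  have comm : ∀ {x y : ClosedTerm Act M} {p : Summand Act M},
      (∀ {p}, p ∈ summands γ x → restDepth p.2 < depth x) →
      (∀ {p}, p ∈ summands γ y → restDepth p.2 < depth y) →
      p ∈ commList γ (summands γ x) (summands γ y) → restDepth p.2 < depth x + depth y := by
    rintro x y ⟨a, o⟩ ih ih' h
    obtain ⟨p, hp, q, hq, -, rfl⟩ := mem_commList.mp h
    have := ih hp
    have := ih' hq
    rw [restDepth_parRest]
    omega
  intro t
  induction t with
  | var X => exact X.elim
  | act a =>
    intro p h
    obtain rfl := List.mem_singleton.mp h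
    exact Nat.zero_lt_one
  | dead | palt => exact fun h => absurd h List.not_mem_nil
  | alt x y ihx ihy =>
    intro p h
    rcases List.mem_append.mp h with h | h
    · exact lt_max_of_lt_left (ihx h)
    · exact lt_max_of_lt_right (ihy h)
  | seq x y ihx ihy => exact follow ihx fun s => rfl
  | lmerge x y ihx ihy => exact follow ihx fun s => rfl
  | cmerge x y ihx ihy => exact comm ihx ihy
  | par x y ihx ihy =>
    intro p h
    rcases List.mem_append.mp h with h | h
    · exact follow ihx (fun s => rfl) h
    rcases List.mem_append.mp h with h | h
    · exact (follow ihy (fun s => rfl) h).trans_eq (add_comm _ _)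
    · exact comm ihx ihy h
  | encap H x ih =>
    rintro ⟨a, o⟩ h
    obtain ⟨-, o', h', rfl⟩ := mem_encapList.mp h
    have := ih h'
    cases o' <;> exact this

/-! ### Head normal forms -/

variable {γ : Option Act → Option Act → Option Act}

open DClass

/-- The class of a summand. -/
def Summand.cls (γ : Option Act → Option Act → Option Act) (p : Summand Act M) : DClass M γ :=
  p.2.elim (DClass.const γ (some p.1)) fun s =>
    DClass.seq (DClass.const γ (some p.1)) (PACP.cls γ s)

/-- The class of the alternative composition of a list of summands. -/
def sumCls (γ : Option Act → Option Act → Option Act) (l : List (Summand Act M)) : DClass M γ :=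
  (l.map (Summand.cls γ)).sum

theorem sumCls_nil : sumCls γ ([] : List (Summand Act M)) = 0 := rfl

theorem sumCls_cons (p : Summand Act M) (l : List (Summand Act M)) :
    sumCls γ (p :: l) = p.cls γ + sumCls γ l := List.sum_cons

theorem sumCls_append (l l' : List (Summand Act M)) :
    sumCls γ (l ++ l') = sumCls γ l + sumCls γ l' := by
  rw [sumCls, List.map_append, List.sum_append]
  rfl

/-- A3' gives idempotence for constants only; A4 extends it to a constant followed by a term. -/
theorem Summand.cls_add_self (p : Summand Act M) : p.cls γ + p.cls γ = p.cls γ := by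
  obtain ⟨a, _ | s⟩ := p
  · exact const_add_const (some a)
  · exact (seq_add (DClass.const γ (some a)) (DClass.const γ (some a)) (PACP.cls γ s)).symm.trans
      (congrArg (DClass.seq · _) (const_add_const (some a)))

/-- Each summand is idempotent and is therefore absorbed by any sum that contains it. Absorption in
both directions gives equality of sums, whatever the order and multiplicity of summands. -/
theorem sumCls_add_of_forall_mem {l l' : List (Summand Act M)}
    (h : ∀ p ∈ l, ∃ q ∈ l', p.cls γ = q.cls γ) : sumCls γ l + sumCls γ l' = sumCls γ l' := by
  have key : ∀ (l' : List (Summand Act M)), ∀ q ∈ l', q.cls γ + sumCls γ l' = sumCls γ l' := by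
    intro l' q hq
    induction l' with
    | nil => exact absurd hq List.not_mem_nil
    | cons r l' ih =>
      rw [sumCls_cons]
      rcases List.mem_cons.mp hq with rfl | hq
      · rw [← add_assoc, Summand.cls_add_self]
      · rw [add_left_comm, ih hq]
  induction l with
  | nil => rw [sumCls_nil, zero_add]
  | cons p l ih =>
    obtain ⟨q, hq, e⟩ := h p List.mem_cons_self
    rw [sumCls_cons, add_assoc, ih fun p hp => h p (List.mem_cons_of_mem _ hp), e, key l' q hq]

theorem sumCls_add_self (l : List (Summand Act M)) : sumCls γ l + sumCls γ l = sumCls γ l :=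
  sumCls_add_of_forall_mem fun p hp => ⟨p, hp, rfl⟩

theorem sumCls_eq_of_forall_mem {l l' : List (Summand Act M)}
    (h : ∀ p ∈ l, ∃ q ∈ l', p.cls γ = q.cls γ) (h' : ∀ q ∈ l', ∃ p ∈ l, q.cls γ = p.cls γ) :
    sumCls γ l = sumCls γ l' := by
  rw [← sumCls_add_of_forall_mem h', add_comm, sumCls_add_of_forall_mem h]

theorem seq_sumCls (y : ClosedTerm Act M) (l : List (Summand Act M)) :
    DClass.seq (sumCls γ l) (cls γ y) = sumCls γ (followList (fun s => Term.seq s y) y l) := by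
  induction l with
  | nil => exact zero_seq _
  | cons p l ih =>
    rw [sumCls_cons, seq_add, ih]
    refine (congrArg (· + _) ?_).trans (sumCls_cons _ _).symm
    obtain ⟨a, _ | s⟩ := p
    · rfl
    · exact DClass.seq_assoc (DClass.const γ (some a)) (cls γ s) (cls γ y)

theorem lmerge_sumCls (y : ClosedTerm Act M) (l : List (Summand Act M)) :
    DClass.lmerge (sumCls γ l) (cls γ y) = sumCls γ (followList (fun s => Term.par s y) y l) := by
  induction l with
  | nil => exact zero_lmerge _
  | cons p l ih =>
    rw [sumCls_cons, lmerge_add, ih]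
    refine (congrArg (· + _) ?_).trans (sumCls_cons _ _).symm
    obtain ⟨a, _ | s⟩ := p
    · exact const_lmerge (some a) _
    · exact const_seq_lmerge (some a) (cls γ s) (cls γ y)

theorem cls_cmerge_cls (p q : Summand Act M) :
    DClass.cmerge (p.cls γ) (q.cls γ) =
      (parRest p.2 q.2).elim (DClass.const γ (γ (some p.1) (some q.1)))
      fun s => DClass.seq (DClass.const γ (γ (some p.1) (some q.1))) (cls γ s) := by
  obtain ⟨a, _ | s⟩ := p <;> obtain ⟨b, _ | s'⟩ := q
  · exact const_cmerge_const (some a) (some b)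
  · exact const_cmerge_const_seq (some a) (some b) (cls γ s')
  · exact const_seq_cmerge_const (some a) (some b) (cls γ s)
  · exact const_seq_cmerge_const_seq (some a) (some b) (cls γ s) (cls γ s')

theorem cmerge_sumCls (l l' : List (Summand Act M)) :
    DClass.cmerge (sumCls γ l) (sumCls γ l') = sumCls γ (commList γ l l') := by
  induction l with
  | nil => exact zero_cmerge _
  | cons p l ih =>
    rw [sumCls_cons, add_cmerge, ih]
    refine (congrArg (· + _) ?_).trans (sumCls_append (l'.filterMap (commSummand γ p)) _).symm
    clear ih
    induction l' with
    | nil => exact cmerge_zero _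
    | cons q l' ih =>
      rw [sumCls_cons, cmerge_add, ih, cls_cmerge_cls, List.filterMap_cons, commSummand]
      cases γ (some p.1) (some q.1) with
      -- When the actions do not communicate, the product is inaction, possibly followed by a term
      -- that A7 removes; `commList` omits it.
      | none =>
        refine (congrArg (· + _) ?_).trans (zero_add _)
        cases parRest p.2 q.2 with
        | none => rfl
        | some s => exact zero_seq (cls γ s)
      | some c => exact (sumCls_cons (c, parRest p.2 q.2) _).symm

theorem encap_sumCls (H : Set Act) (l : List (Summand Act M)) :
    DClass.encap H (sumCls γ l) = sumCls γ (l.filterMap (encapSummand H)) := by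
  induction l with
  | nil => exact encap_zero H
  | cons p l ih =>
    rw [sumCls_cons, encap_add, ih, List.filterMap_cons, encapSummand]
    split_ifs with h
    · refine (congrArg (· + _) ?_).trans (zero_add _)
      obtain ⟨a, _ | s⟩ := p
      · exact encap_const_of_mem h
      · exact (encap_seq H (DClass.const γ (some a)) (cls γ s)).trans
          ((congrArg (DClass.seq · _) (encap_const_of_mem h)).trans (zero_seq _))
    · refine (congrArg (· + _) ?_).trans (sumCls_cons _ _).symm
      obtain ⟨a, _ | s⟩ := p
      · exact encap_const_of_notMem h
      · exact (encap_seq H (DClass.const γ (some a)) (cls γ s)).trans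
          (congrArg (DClass.seq · _) (encap_const_of_notMem h))

theorem Resolved.cls_eq_sumCls {t : ClosedTerm Act M} (ht : Resolved t) :
    cls γ t = sumCls γ (summands γ t) := by
  induction ht with
  | act a => exact (add_zero _).symm
  | dead => rfl
  | alt _ _ ihx ihy => exact (congrArg₂ (· + ·) ihx ihy).trans (sumCls_append _ _).symm
  | seq y _ ih => exact (congrArg (DClass.seq · _) ih).trans (seq_sumCls _ _)
  | lmerge _ _ ih => exact (congrArg (DClass.lmerge · _) ih).trans (lmerge_sumCls _ _)
  | cmerge _ _ ihx ihy => exact (congrArg₂ DClass.cmerge ihx ihy).trans (cmerge_sumCls _ _)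
  | encap H _ ih => exact (congrArg (DClass.encap H) ih).trans (encap_sumCls _ _)
  | @par x y _ _ ihx ihy =>
    -- The head normal forms of the components supply the premises of the conditional axiom CM1'.
    have hx : cls γ x + cls γ x = cls γ x := by rw [ihx, sumCls_add_self]
    have hy : cls γ y + cls γ y = cls γ y := by rw [ihy, sumCls_add_self]
    refine (par_eq hx hy).trans ?_
    rw [summands, sumCls_append, sumCls_append, ← lmerge_sumCls, ← lmerge_sumCls, ← cmerge_sumCls,
      ← ihx, ← ihy]

theorem Resolved.cls_add_self {t : ClosedTerm Act M} (ht : Resolved t) :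
    cls γ t + cls γ t = cls γ t := by
  rw [ht.cls_eq_sumCls, sumCls_add_self]

/-- The merges of two resolved terms in either order are equal if this holds for what remains to
be done after their first actions. -/
theorem Resolved.par_comm_of_forall_mem (γ_comm : ∀ a b : Option Act, γ a b = γ b a)
    {x y : ClosedTerm Act M} (hx : Resolved x) (hy : Resolved y)
    (h : ∀ p ∈ summands γ x, ∀ q ∈ summands γ y, ∀ s ∈ p.2, ∀ s' ∈ q.2,
      DClass.par (cls γ s) (cls γ s') = DClass.par (cls γ s') (cls γ s)) :
    DClass.par (cls γ x) (cls γ y) = DClass.par (cls γ y) (cls γ x) := by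
  have key : ∀ p ∈ summands γ x, ∀ q ∈ summands γ y,
      DClass.cmerge (p.cls γ) (q.cls γ) = DClass.cmerge (q.cls γ) (p.cls γ) := by
    intro p hp q hq
    rw [cls_cmerge_cls, cls_cmerge_cls, γ_comm]
    have := h p hp q hq
    obtain ⟨a, _ | s⟩ := p <;> obtain ⟨b, _ | s'⟩ := q
    · rfl
    · rfl
    · rfl
    · exact congrArg (DClass.seq _) (this s rfl s' rfl)
  -- Communication merge distributes over sums on both sides, so commutation of the individual
  -- summands suffices.
  have swap : ∀ l l' : List (Summand Act M),
      (∀ p ∈ l, ∀ q ∈ l', DClass.cmerge (p.cls γ) (q.cls γ) = DClass.cmerge (q.cls γ) (p.cls γ)) →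
      DClass.cmerge (sumCls γ l) (sumCls γ l') = DClass.cmerge (sumCls γ l') (sumCls γ l) := by
    intro l l' h
    induction l with
    | nil => rw [sumCls_nil, zero_cmerge, cmerge_zero]
    | cons p l ih =>
      rw [sumCls_cons, add_cmerge, cmerge_add, ih fun p hp => h p (List.mem_cons_of_mem _ hp)]
      congr 1
      have h' := h p List.mem_cons_self
      clear ih h
      induction l' with
      | nil => rw [sumCls_nil, zero_cmerge, cmerge_zero]
      | cons q l' ih =>
        rw [sumCls_cons, add_cmerge, cmerge_add, ih fun q hq => h' q (List.mem_cons_of_mem _ hq),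
          h' q List.mem_cons_self]
  -- Under CM1' the two left merges merely exchange places.
  rw [par_eq hx.cls_add_self hy.cls_add_self, par_eq hy.cls_add_self hx.cls_add_self,
    hx.cls_eq_sumCls, hy.cls_eq_sumCls, swap _ _ key, add_left_comm]

end Summands

end PACP

/-! ### The distribution of the resolved behaviours of a closed term -/

namespace PACP

open SignedCancellationMeadow Term ConvexAlgebra

section Distribution

variable {Act : Type u} {M : Type v} [SignedCancellationMeadow M]

/-- The image under `f` of the product of two finitely supported weight functions. -/
noncomputable def comb {S : Type v} [Semiring S] {α : Type w} (f : α → α → α) (d e : α →₀ S) :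
    α →₀ S :=
  d.sum fun x p => e.sum fun y q => Finsupp.single (f x y) (p * q)

/-- For an injective `f`, such as a term constructor, only one pair of arguments contributes to a
given value. -/
theorem comb_apply {S : Type v} [Semiring S] {α : Type w} {f : α → α → α}
    (hf : Function.Injective2 f) (d e : α →₀ S) (x y : α) :
    comb f d e (f x y) = d x * e y := by
  classical
  simp only [comb, Finsupp.sum, Finsupp.finsetSum_apply, Finsupp.single_apply, hf.eq_iff, ite_and]
  rw [Finset.sum_eq_single x, Finset.sum_eq_single y]
  · simp
  · intro b _ hb
    simp [hb]
  · intro h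
    simp [Finsupp.notMem_support_iff.mp h]
  · intro b _ hb
    simp [hb]
  · intro h
    simp [Finsupp.notMem_support_iff.mp h]

theorem exists_of_comb_ne_zero {S : Type v} [Semiring S] {α : Type w} {f : α → α → α}
    {d e : α →₀ S} {u : α} (h : comb f d e u ≠ 0) :
    ∃ x y, d x ≠ 0 ∧ e y ≠ 0 ∧ u = f x y := by
  classical
  simp only [comb, Finsupp.sum, Finsupp.finsetSum_apply] at h
  obtain ⟨x, hx, h⟩ := Finset.exists_ne_zero_of_sum_ne_zero h
  obtain ⟨y, hy, h⟩ := Finset.exists_ne_zero_of_sum_ne_zero h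
  refine ⟨x, y, Finsupp.mem_support_iff.mp hx, Finsupp.mem_support_iff.mp hy, ?_⟩
  by_contra hu
  exact h (Finsupp.single_eq_of_ne hu)

theorem linearCombination_comb {S : Type v} [Semiring S] {α : Type w} {N : Type*}
    [AddCommMonoid N] [Module S N] (v : α → N) (f : α → α → α) (d e : α →₀ S) :
    Finsupp.linearCombination S v (comb f d e) =
      d.sum fun x p => p • e.sum fun y q => q • v (f x y) := by
  simp only [comb, map_finsuppSum, Finsupp.linearCombination_single, Finsupp.smul_sum, mul_smul]

/-- The probabilities with which a closed term behaves as other closed terms. -/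
noncomputable def dist : ClosedTerm Act M → (ClosedTerm Act M →₀ nonNegSubsemiring M)
  | var X => X.elim
  | act a => Finsupp.single (act a) 1
  | dead => Finsupp.single dead 1
  | alt x y => comb alt (dist x) (dist y)
  | seq x y => (dist x).mapDomain fun x' => seq x' y
  | palt π x y => π.toNonNeg • dist x + π.compl.toNonNeg • dist y
  | par x y => comb par (dist x) (dist y)
  | lmerge x y => comb lmerge (dist x) (dist y)
  | cmerge x y => comb cmerge (dist x) (dist y)
  | encap H x => (dist x).mapDomain (encap H)

/-- The depth bound allows passing from a term to its resolved behaviours within an induction on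
depth. -/
theorem resolved_of_dist_ne_zero : ∀ {t r : ClosedTerm Act M}, dist t r ≠ 0 →
    Resolved r ∧ depth r ≤ depth t := by
  intro t
  have map : ∀ {f : ClosedTerm Act M → ClosedTerm Act M} {d} {r : ClosedTerm Act M},
      Finsupp.mapDomain (M := nonNegSubsemiring M) f d r ≠ 0 → ∃ x, d x ≠ 0 ∧ r = f x := by
    classical
    intro f d r h
    obtain ⟨x, hx, rfl⟩ := Finset.mem_image.mp
      (Finsupp.mapDomain_support (Finsupp.mem_support_iff.mpr h))
    exact ⟨x, Finsupp.mem_support_iff.mp hx, rfl⟩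
  induction t with
  | var X => exact X.elim
  | act a =>
    intro r h
    obtain rfl : r = act a := not_not.mp fun h' => h (Finsupp.single_eq_of_ne h')
    exact ⟨.act a, le_rfl⟩
  | dead =>
    intro r h
    obtain rfl : r = dead := not_not.mp fun h' => h (Finsupp.single_eq_of_ne h')
    exact ⟨.dead, le_rfl⟩
  | palt π x y ihx ihy =>
    intro r h
    by_cases hx : dist x r = 0
    · by_cases hy : dist y r = 0
      · refine absurd ?_ h
        change π.toNonNeg • dist x r + π.compl.toNonNeg • dist y r = 0
        rw [hx, hy, smul_zero, smul_zero, add_zero]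
      · exact ⟨(ihy hy).1, le_max_of_le_right (ihy hy).2⟩
    · exact ⟨(ihx hx).1, le_max_of_le_left (ihx hx).2⟩
  | seq x y ih =>
    intro r h
    obtain ⟨x', hx, rfl⟩ := map h
    exact ⟨.seq y (ih hx).1, Nat.add_le_add_right (ih hx).2 _⟩
  | encap H x ih =>
    intro r h
    obtain ⟨x', hx, rfl⟩ := map h
    exact ⟨.encap H (ih hx).1, (ih hx).2⟩
  | alt x y ihx ihy =>
    intro r h
    obtain ⟨x', y', hx, hy, rfl⟩ := exists_of_comb_ne_zero h
    exact ⟨.alt (ihx hx).1 (ihy hy).1, max_le_max (ihx hx).2 (ihy hy).2⟩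
  | par x y ihx ihy =>
    intro r h
    obtain ⟨x', y', hx, hy, rfl⟩ := exists_of_comb_ne_zero h
    exact ⟨.par (ihx hx).1 (ihy hy).1, Nat.add_le_add (ihx hx).2 (ihy hy).2⟩
  | lmerge x y ihx ihy =>
    intro r h
    obtain ⟨x', y', hx, hy, rfl⟩ := exists_of_comb_ne_zero h
    exact ⟨.lmerge (ihx hx).1 (ihy hy).1, Nat.add_le_add (ihx hx).2 (ihy hy).2⟩
  | cmerge x y ihx ihy =>
    intro r h
    obtain ⟨x', y', hx, hy, rfl⟩ := exists_of_comb_ne_zero h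
    exact ⟨.cmerge (ihx hx).1 (ihy hy).1, Nat.add_le_add (ihx hx).2 (ihy hy).2⟩

/-- If the positive rules allow at most the label `w`, and do yield it when it is nonzero, the
negative rule fills exactly the remaining gap at `w = 0`. -/
theorem addZeroSteps_iff {S : Prob M → ClosedTerm Act M → Prop} {t' : ClosedTerm Act M}
    {w : Prob M} (h : ∀ π, S π t' → π = w) (hw : w ≠ 0 → S w t') (π : Prob M) :
    addZeroSteps S π t' ↔ π = w := by
  constructor
  · rintro (hS | ⟨rfl, hS⟩)
    · exact h π hS
    · by_contra h0
      exact hS w (Ne.symm h0) (hw (Ne.symm h0))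
  · rintro rfl
    by_cases hπ : π = 0
    · by_cases hS : S π t'
      · exact Or.inl hS
      · exact Or.inr ⟨hπ, fun ρ hρ hS' => hρ ((h ρ hS').trans hπ)⟩
    · exact Or.inl (hw hπ)

/-- The label of the probabilistic step from `t` to `t'` is unique and is given by `dist`. -/
theorem exists_forall_pStep_iff : ∀ t t' : ClosedTerm Act M,
    ∃ w : Prob M, w.toNonNeg = dist t t' ∧ ∀ π, PStep t π t' ↔ π = w := by
  have base : ∀ c t' : ClosedTerm Act M, ∃ w : Prob M,
      w.toNonNeg = Finsupp.single (M := nonNegSubsemiring M) c 1 t' ∧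
      ∀ π, addZeroSteps (fun π t' => π = 1 ∧ t' = c) π t' ↔ π = w := by
    intro c t'
    by_cases h : t' = c
    · subst h
      exact ⟨1, Finsupp.single_eq_same.symm, addZeroSteps_iff (fun _ h => h.1) fun _ => ⟨rfl, rfl⟩⟩
    · exact ⟨0, (Finsupp.single_eq_of_ne h).symm, addZeroSteps_iff (fun _ h' => absurd h'.2 h)
        fun h' => absurd rfl h'⟩
  have unary : ∀ (f : ClosedTerm Act M → ClosedTerm Act M) (x t' : ClosedTerm Act M),
      Function.Injective f →
      (∀ t', ∃ w : Prob M, w.toNonNeg = dist x t' ∧ ∀ π, PStep x π t' ↔ π = w) →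
      ∃ w : Prob M, w.toNonNeg = (dist x).mapDomain f t' ∧
        ∀ π, addZeroSteps (fun σ t' => ∃ x', PStep x σ x' ∧ t' = f x') π t' ↔ π = w := by
    intro f x t' hf ih
    by_cases h : ∃ x', t' = f x'
    · obtain ⟨x', rfl⟩ := h
      obtain ⟨w, hw, hx⟩ := ih x'
      refine ⟨w, by rw [hw, Finsupp.mapDomain_apply hf], addZeroSteps_iff ?_ ?_⟩
      · rintro π ⟨x'', h, e⟩
        rw [← hf e] at h
        exact (hx π).mp h
      · exact fun _ => ⟨x', (hx w).mpr rfl, rfl⟩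
    · refine ⟨0, ?_, addZeroSteps_iff ?_ fun h' => absurd rfl h'⟩
      · rw [Finsupp.mapDomain_of_notMem_range _ _ fun ⟨x', e⟩ => h ⟨x', e.symm⟩]
        rfl
      · rintro π ⟨x', -, e⟩
        exact absurd ⟨x', e⟩ h
  have binary : ∀ (f : ClosedTerm Act M → ClosedTerm Act M → ClosedTerm Act M)
      (x y t' : ClosedTerm Act M), Function.Injective2 f →
      (∀ t', ∃ w : Prob M, w.toNonNeg = dist x t' ∧ ∀ π, PStep x π t' ↔ π = w) →
      (∀ t', ∃ w : Prob M, w.toNonNeg = dist y t' ∧ ∀ π, PStep y π t' ↔ π = w) →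
      ∃ w : Prob M, w.toNonNeg = comb f (dist x) (dist y) t' ∧
        ∀ π, addZeroSteps (fun σ t' =>
          ∃ π x' ρ y', PStep x π x' ∧ PStep y ρ y' ∧ σ = π * ρ ∧ t' = f x' y') π t' ↔ π = w := by
    intro f x y t' hf ihx ihy
    by_cases h : ∃ x' y', t' = f x' y'
    · obtain ⟨x', y', rfl⟩ := h
      obtain ⟨w, hw, hx⟩ := ihx x'
      obtain ⟨w', hw', hy⟩ := ihy y'
      refine ⟨w * w', by rw [comb_apply hf, ← hw, ← hw']; rfl, addZeroSteps_iff ?_ ?_⟩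
      · rintro σ ⟨π, x'', ρ, y'', h, h', rfl, e⟩
        obtain ⟨rfl, rfl⟩ := hf e
        rw [(hx π).mp h, (hy ρ).mp h']
      · exact fun _ => ⟨w, x', w', y', (hx w).mpr rfl, (hy w').mpr rfl, rfl, rfl⟩
    · refine ⟨0, ?_, addZeroSteps_iff ?_ fun h' => absurd rfl h'⟩
      · by_contra h'
        obtain ⟨x', y', -, -, e⟩ := exists_of_comb_ne_zero (Ne.symm h')
        exact h ⟨x', y', e⟩
      · rintro π ⟨-, x', -, y', -, -, -, e⟩
        exact absurd ⟨x', y', e⟩ h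
  intro t
  induction t with
  | var X => exact X.elim
  | act a => exact base (act a)
  | dead => exact base dead
  | alt x y ihx ihy => exact fun t' => binary alt x y t' (fun _ _ _ _ h => by simpa using h) ihx ihy
  | par x y ihx ihy => exact fun t' => binary par x y t' (fun _ _ _ _ h => by simpa using h) ihx ihy
  | lmerge x y ihx ihy =>
    exact fun t' => binary lmerge x y t' (fun _ _ _ _ h => by simpa using h) ihx ihy
  | cmerge x y ihx ihy =>
    exact fun t' => binary cmerge x y t' (fun _ _ _ _ h => by simpa using h) ihx ihy
  | seq x y ihx =>
    exact fun t' => unary (fun x' => seq x' y) x t' (fun _ _ h => by simpa using h) ihx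
  | encap H x ihx => exact fun t' => unary (encap H) x t' (fun _ _ h => by simpa using h) ihx
  | palt π x y ihx ihy =>
    intro t'
    obtain ⟨w, hw, hx⟩ := ihx t'
    obtain ⟨w', hw', hy⟩ := ihy t'
    refine ⟨Prob.mix π w w', ?_, addZeroSteps_iff ?_ ?_⟩
    · change _ = π.toNonNeg • dist x t' + π.compl.toNonNeg • dist y t'
      rw [← hw, ← hw']
      rfl
    · rintro σ ⟨ρ, ρ', h, h', rfl⟩
      rw [(hx ρ).mp h, (hy ρ').mp h']
    · exact fun _ => ⟨w, w', (hx w).mpr rfl, (hy w').mpr rfl, rfl⟩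

theorem prob_eq_dist (t t' : ClosedTerm Act M) : prob t t' = (dist t t').1 := by
  obtain ⟨w, hw, h⟩ := exists_forall_pStep_iff t t'
  simp only [prob, h]
  rw [finsum_eq_single _ w fun π hπ => by simp [hπ], ← hw]
  simp [Prob.toNonNeg]

theorem probSet_eq_sum (t : ClosedTerm Act M) (T : Set (ClosedTerm Act M)) [DecidablePred (· ∈ T)] :
    probSet t T = ((dist t).sum fun r p => if r ∈ T then p else 0).1 := by
  simp only [probSet, prob_eq_dist, Finsupp.sum]
  rw [finsum_eq_sum_of_support_subset (s := (dist t).support)]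
  · rw [AddSubmonoidClass.coe_finsetSum]
    refine Finset.sum_congr rfl fun r _ => ?_
    by_cases hr : r ∈ T <;> simp [hr]
  · intro r hr
    rw [Finset.mem_coe, Finsupp.mem_support_iff]
    intro h
    exact hr (by simp [h])

/-- This discharges the premises on the idle component in the action rules for `alt` and `par`. -/
theorem Resolved.pStep_one {t : ClosedTerm Act M} (ht : Resolved t) : PStep t 1 t := by
  have one : (1 : Prob M) = 1 * 1 := Subtype.ext (one_mul 1).symm
  induction ht with
  | act a => exact Or.inl ⟨rfl, rfl⟩
  | dead => exact Or.inl ⟨rfl, rfl⟩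
  | seq _ _ ih => exact Or.inl ⟨_, ih, rfl⟩
  | encap _ _ ih => exact Or.inl ⟨_, ih, rfl⟩
  | alt _ _ ihx ihy | par _ _ ihx ihy | lmerge _ _ ihx ihy | cmerge _ _ ihx ihy =>
    exact Or.inl ⟨_, _, _, _, ihx, ihy, one, rfl⟩

variable {γ : Option Act → Option Act → Option Act}

/-- With one argument fixed, `F` is affine and extends to a linear map of the cone by `Cone.map`.
Applying this to each argument in turn expands `F` over both distributions. -/
theorem linearCombination_comb_dist {F : DClass M γ → DClass M γ → DClass M γ}
    {f : ClosedTerm Act M → ClosedTerm Act M → ClosedTerm Act M}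
    (hf : ∀ x y, F (cls γ x) (cls γ y) = cls γ (f x y))
    (mixF : ∀ (π : Prob M) z x y, F (mix π x y) z = mix π (F x z) (F y z))
    (Fmix : ∀ (π : Prob M) z x y, F z (mix π x y) = mix π (F z x) (F z y)) {x y : ClosedTerm Act M}
    (hx : Finsupp.linearCombination (nonNegSubsemiring M) (fun r => Cone.of (cls γ r)) (dist x) =
      Cone.of (M := M) (cls γ x))
    (hy : Finsupp.linearCombination (nonNegSubsemiring M) (fun r => Cone.of (cls γ r)) (dist y) =
      Cone.of (M := M) (cls γ y)) :
    Finsupp.linearCombination (nonNegSubsemiring M) (fun r => Cone.of (cls γ r))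
      (comb f (dist x) (dist y)) = Cone.of (M := M) (cls γ (f x y)) := by
  rw [linearCombination_comb, ← hf, ← Cone.map_of (F · (cls γ y)) fun π => mixF π _, ← hx,
    Finsupp.linearCombination_apply, map_finsuppSum]
  refine Finsupp.sum_congr fun x' _ => ?_
  rw [map_smul, Cone.map_of, ← Cone.map_of (F (cls γ x')) fun π => Fmix π _, ← hy,
    Finsupp.linearCombination_apply, map_finsuppSum]
  congr 1
  refine Finsupp.sum_congr fun y' _ => ?_
  rw [map_smul, Cone.map_of, hf]

/-- A closed term is derivably equal to the mixture of its resolved behaviours. -/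
theorem linearCombination_dist (t : ClosedTerm Act M) :
    Finsupp.linearCombination (nonNegSubsemiring M) (fun r => Cone.of (cls γ r)) (dist t) =
      Cone.of (M := M) (cls γ t) := by
  have unary : ∀ {F : DClass M γ → DClass M γ} {f : ClosedTerm Act M → ClosedTerm Act M}
      (_ : ∀ x, F (cls γ x) = cls γ (f x))
      (_ : ∀ (π : Prob M) x y, F (mix π x y) = mix π (F x) (F y)) {x : ClosedTerm Act M}
      (_ : Finsupp.linearCombination (nonNegSubsemiring M) (fun r => Cone.of (cls γ r)) (dist x) =
        Cone.of (M := M) (cls γ x)),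
      Finsupp.linearCombination (nonNegSubsemiring M) (fun r => Cone.of (cls γ r))
        ((dist x).mapDomain f) = Cone.of (M := M) (cls γ (f x)) := by
    intro F f hf mixF x hx
    rw [← hf, ← Cone.map_of F mixF, ← hx, Finsupp.linearCombination_mapDomain,
      Finsupp.linearCombination_apply, Finsupp.linearCombination_apply, map_finsuppSum]
    refine Finsupp.sum_congr fun x' _ => ?_
    rw [map_smul, Cone.map_of, hf]
    rfl
  induction t with
  | var X => exact X.elim
  | act a | dead => rw [dist, Finsupp.linearCombination_single, one_smul]
  | palt π x y ihx ihy =>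
    rw [dist, map_add, map_smul, map_smul, ihx, ihy]
    exact (Cone.of_mix π (cls γ x) (cls γ y)).symm
  | seq x y ihx =>
    exact unary (F := (DClass.seq · (cls γ y))) (fun _ => rfl)
      (fun π => DClass.mix_seq π (cls γ y)) ihx
  | encap H x ihx => exact unary (fun _ => rfl) (DClass.encap_mix H) ihx
  | alt x y ihx ihy =>
    exact linearCombination_comb_dist (F := (· + ·)) (fun _ _ => rfl) DClass.mix_add DClass.add_mix
      ihx ihy
  | par x y ihx ihy =>
    exact linearCombination_comb_dist (fun _ _ => rfl) DClass.mix_par DClass.par_mix ihx ihy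
  | lmerge x y ihx ihy =>
    exact linearCombination_comb_dist (fun _ _ => rfl) DClass.mix_lmerge DClass.lmerge_mix ihx ihy
  | cmerge x y ihx ihy =>
    exact linearCombination_comb_dist (fun _ _ => rfl) DClass.mix_cmerge DClass.cmerge_mix ihx ihy

/-- Parallel composition of closed terms is derivably commutative. -/
theorem par_comm_of_comm (γ_comm : ∀ a b : Option Act, γ a b = γ b a) (x y : ClosedTerm Act M) :
    cls γ (par x y) = cls γ (par y x) := by
  obtain ⟨n, hn⟩ : ∃ n, depth x + depth y < n := ⟨_, Nat.lt_succ_self _⟩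
  induction n generalizing x y with
  | zero => omega
  | succ n ih =>
    -- In the cone both sides are double sums over pairs of resolved behaviours, so the claim
    -- reduces to such pairs, and from these to the remainders of their summands, whose total depth
    -- is smaller.
    apply Cone.of_injective (M := M)
    rw [← linearCombination_dist, ← linearCombination_dist, dist, dist, linearCombination_comb,
      linearCombination_comb]
    simp only [Finsupp.smul_sum]
    rw [Finsupp.sum_comm]
    refine Finsupp.sum_congr fun y' hy => Finsupp.sum_congr fun x' hx => ?_
    have hx := resolved_of_dist_ne_zero (Finsupp.mem_support_iff.mp hx)
    have hy := resolved_of_dist_ne_zero (Finsupp.mem_support_iff.mp hy)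
    have key : cls γ (par x' y') = cls γ (par y' x') := by
      refine hx.1.par_comm_of_forall_mem γ_comm hy.1 fun p hp q hq s hs s' hs' => ih s s' ?_
      have h := restDepth_lt hp
      have h' := restDepth_lt hq
      rw [Option.mem_def.mp hs] at h
      rw [Option.mem_def.mp hs'] at h'
      simp only [restDepth, Option.elim] at h h'
      omega
    rw [key, smul_comm]

end Distribution

end PACP

/-! ### Completeness -/

namespace PACP

open SignedCancellationMeadow Term ConvexAlgebra

section Completeness

variable {Act : Type u} {M : Type v} [SignedCancellationMeadow M]
  {γ : Option Act → Option Act → Option Act}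

/-! ### Summands of resolved terms versus action steps. -/

theorem Resolved.aTerm_iff {t : ClosedTerm Act M} (ht : Resolved t) {a : Act} :
    ATerm γ t a ↔ (a, none) ∈ summands γ t := by
  have follow : ∀ {f : ClosedTerm Act M → ClosedTerm Act M} {y : ClosedTerm Act M}
      {l : List (Summand Act M)} {a : Act}, (a, none) ∉ followList f y l := by
    intro f y l a h
    rcases mem_followList.mp h with ⟨-, h⟩ | ⟨_, -, h⟩ <;> cases h
  have comm : ∀ {x y : ClosedTerm Act M} {c : Act},
      (∀ {a}, ATerm γ x a ↔ (a, none) ∈ summands γ x) →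
      (∀ {a}, ATerm γ y a ↔ (a, none) ∈ summands γ y) →
      ((c, none) ∈ commList γ (summands γ x) (summands γ y) ↔
        ∃ a b, ATerm γ x a ∧ ATerm γ y b ∧ γ (some a) (some b) = some c) := by
    intro x y c ihx ihy
    rw [mem_commList]
    constructor
    · rintro ⟨⟨a, _ | _⟩, hp, ⟨b, _ | _⟩, hq, h, e⟩
      · exact ⟨a, b, ihx.mpr hp, ihy.mpr hq, h⟩
      all_goals cases e
    · rintro ⟨a, b, hp, hq, h⟩
      exact ⟨(a, none), ihx.mp hp, (b, none), ihy.mp hq, h, rfl⟩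
  induction ht generalizing a with
  | act b =>
    constructor
    · rintro ⟨⟩
      exact List.mem_singleton_self _
    · intro h
      cases List.mem_singleton.mp h
      exact .act b
  | dead => exact ⟨fun h => (nomatch h), fun h => absurd h List.not_mem_nil⟩
  | alt hx hy ihx ihy =>
    rw [summands, List.mem_append]
    constructor
    · rintro (_ | _)
      · exact Or.inl (ihx.mp ‹_›)
      · exact Or.inr (ihy.mp ‹_›)
    · rintro (h | h)
      · exact .alt_left (ihx.mpr h) hy.pStep_one
      · exact .alt_right hx.pStep_one (ihy.mpr h)
  | seq y _ _ => exact ⟨fun h => (nomatch h), fun h => absurd h follow⟩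
  | lmerge _ _ _ _ => exact ⟨fun h => (nomatch h), fun h => absurd h follow⟩
  | cmerge hx hy ihx ihy =>
    rw [summands, comm ihx ihy]
    constructor
    · rintro ⟨⟩
      exact ⟨_, _, ‹_›, ‹_›, ‹_›⟩
    · rintro ⟨a, b, h, h', e⟩
      exact .cmerge h h' e
  | par hx hy ihx ihy =>
    rw [summands, List.mem_append, List.mem_append, comm ihx ihy]
    constructor
    · rintro ⟨⟩
      exact Or.inr (Or.inr ⟨_, _, ‹_›, ‹_›, ‹_›⟩)
    · rintro (h | h | ⟨a, b, h, h', e⟩)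
      · exact absurd h follow
      · exact absurd h follow
      · exact .par h h' e
  | encap H hx ih =>
    rw [summands, mem_encapList]
    constructor
    · rintro ⟨⟩
      exact ⟨‹_›, none, ih.mp ‹_›, rfl⟩
    · rintro ⟨ha, _ | _, h, e⟩
      · exact .encap (ih.mpr h) ha
      · cases e

/-- Remainders agree only up to derivable equality: a step of the right component of `par` leaves
them in the opposite order, and this discrepancy is inherited by enclosing terms.
`Resolved.exists_aStep` is the converse. -/
theorem Resolved.exists_mem_summands (γ_comm : ∀ a b : Option Act, γ a b = γ b a)
    {t s : ClosedTerm Act M} (ht : Resolved t) {a : Act} (h : AStep γ t a s) :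
    ∃ s', (a, some s') ∈ summands γ t ∧ cls γ s = cls γ s' := by
  induction h with
  | alt_left _ _ ih =>
    cases ht with | alt hx hy
    obtain ⟨s', h, e⟩ := ih hx
    exact ⟨s', List.mem_append_left _ h, e⟩
  | alt_right _ _ ih =>
    cases ht with | alt hx hy
    obtain ⟨s', h, e⟩ := ih hy
    exact ⟨s', List.mem_append_right _ h, e⟩
  | seq_term h =>
    cases ht with | seq _ hx
    exact ⟨_, mem_followList.mpr (Or.inl ⟨hx.aTerm_iff.mp h, rfl⟩), rfl⟩
  | @seq_step _ _ y _ _ ih =>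
    cases ht with | seq _ hx
    obtain ⟨s', h, e⟩ := ih hx
    exact ⟨_, mem_followList.mpr (Or.inr ⟨s', h, rfl⟩), congrArg (DClass.seq · (cls γ y)) e⟩
  | lmerge_term h =>
    cases ht with | lmerge hx _
    exact ⟨_, mem_followList.mpr (Or.inl ⟨hx.aTerm_iff.mp h, rfl⟩), rfl⟩
  | @lmerge_step _ _ y _ _ ih =>
    cases ht with | lmerge hx _
    obtain ⟨s', h, e⟩ := ih hx
    exact ⟨_, mem_followList.mpr (Or.inr ⟨s', h, rfl⟩), congrArg (DClass.par · (cls γ y)) e⟩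
  | par_term_left h _ =>
    cases ht with | par hx _
    exact ⟨_, List.mem_append_left _ (mem_followList.mpr (Or.inl ⟨hx.aTerm_iff.mp h, rfl⟩)), rfl⟩
  | @par_step_left _ _ y _ _ _ _ ih =>
    cases ht with | par hx _
    obtain ⟨s', h, e⟩ := ih hx
    exact ⟨_, List.mem_append_left _ (mem_followList.mpr (Or.inr ⟨s', h, rfl⟩)),
      congrArg (DClass.par · (cls γ y)) e⟩
  | par_term_right _ h =>
    cases ht with | par _ hy
    exact ⟨_, List.mem_append_right _ (List.mem_append_left _
      (mem_followList.mpr (Or.inl ⟨hy.aTerm_iff.mp h, rfl⟩))), rfl⟩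
  | @par_step_right x _ _ _ _ _ _ ih =>
    cases ht with | par _ hy
    obtain ⟨s', h, e⟩ := ih hy
    exact ⟨_, List.mem_append_right _ (List.mem_append_left _
      (mem_followList.mpr (Or.inr ⟨s', h, rfl⟩))),
      -- The operational remainder has `x` on the left, the summand has it on the right.
      (par_comm_of_comm γ_comm _ _).trans (congrArg (DClass.par · (cls γ x)) e)⟩
  | par_term_step h _ hc ih =>
    cases ht with | par hx hy
    obtain ⟨s', h', e⟩ := ih hy
    exact ⟨s', List.mem_append_right _ (List.mem_append_right _
      (mem_commList.mpr ⟨_, hx.aTerm_iff.mp h, _, h', hc, rfl⟩)), e⟩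
  | par_step_term _ h hc ih =>
    cases ht with | par hx hy
    obtain ⟨s', h', e⟩ := ih hx
    exact ⟨s', List.mem_append_right _ (List.mem_append_right _
      (mem_commList.mpr ⟨_, h', _, hy.aTerm_iff.mp h, hc, rfl⟩)), e⟩
  | par_step_step _ _ hc ihx ihy =>
    cases ht with | par hx hy
    obtain ⟨s, h, e⟩ := ihx hx
    obtain ⟨s', h', e'⟩ := ihy hy
    exact ⟨_, List.mem_append_right _ (List.mem_append_right _
      (mem_commList.mpr ⟨_, h, _, h', hc, rfl⟩)), congrArg₂ DClass.par e e'⟩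
  | cmerge_term_step h _ hc ih =>
    cases ht with | cmerge hx hy
    obtain ⟨s', h', e⟩ := ih hy
    exact ⟨s', mem_commList.mpr ⟨_, hx.aTerm_iff.mp h, _, h', hc, rfl⟩, e⟩
  | cmerge_step_term _ h hc ih =>
    cases ht with | cmerge hx hy
    obtain ⟨s', h', e⟩ := ih hx
    exact ⟨s', mem_commList.mpr ⟨_, h', _, hy.aTerm_iff.mp h, hc, rfl⟩, e⟩
  | cmerge_step_step _ _ hc ihx ihy =>
    cases ht with | cmerge hx hy
    obtain ⟨s, h, e⟩ := ihx hx
    obtain ⟨s', h', e'⟩ := ihy hy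
    exact ⟨_, mem_commList.mpr ⟨_, h, _, h', hc, rfl⟩, congrArg₂ DClass.par e e'⟩
  | @encap H _ _ _ _ ha ih =>
    cases ht with | encap _ hx
    obtain ⟨s', h, e⟩ := ih hx
    exact ⟨_, mem_encapList.mpr ⟨ha, _, h, rfl⟩, congrArg (DClass.encap H) e⟩

theorem Resolved.exists_aStep (γ_comm : ∀ a b : Option Act, γ a b = γ b a)
    {t s : ClosedTerm Act M} (ht : Resolved t) {a : Act} (hm : (a, some s) ∈ summands γ t) :
    ∃ s', AStep γ t a s' ∧ cls γ s = cls γ s' := by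
  induction ht generalizing a s with
  | act b => cases List.mem_singleton.mp hm
  | dead => exact absurd hm List.not_mem_nil
  | alt hx hy ihx ihy =>
    rcases List.mem_append.mp hm with h | h
    · obtain ⟨s', h, e⟩ := ihx h
      exact ⟨s', .alt_left h hy.pStep_one, e⟩
    · obtain ⟨s', h, e⟩ := ihy h
      exact ⟨s', .alt_right hx.pStep_one h, e⟩
  | seq y hx ih =>
    rcases mem_followList.mp hm with ⟨h, e⟩ | ⟨r, h, e⟩ <;> cases e
    · exact ⟨_, .seq_term (hx.aTerm_iff.mpr h), rfl⟩
    · obtain ⟨s', h, e⟩ := ih h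
      exact ⟨_, .seq_step h, congrArg (DClass.seq · (cls γ y)) e⟩
  | @lmerge _ y hx _ ih _ =>
    rcases mem_followList.mp hm with ⟨h, e⟩ | ⟨r, h, e⟩ <;> cases e
    · exact ⟨_, .lmerge_term (hx.aTerm_iff.mpr h), rfl⟩
    · obtain ⟨s', h, e⟩ := ih h
      exact ⟨_, .lmerge_step h, congrArg (DClass.par · (cls γ y)) e⟩
  | cmerge hx hy ihx ihy =>
    obtain ⟨⟨a, _ | r⟩, h, ⟨b, _ | r'⟩, h', hc, e⟩ := mem_commList.mp hm <;> cases e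
    · obtain ⟨s', h', e⟩ := ihy h'
      exact ⟨s', .cmerge_term_step (hx.aTerm_iff.mpr h) h' hc, e⟩
    · obtain ⟨s', h, e⟩ := ihx h
      exact ⟨s', .cmerge_step_term h (hy.aTerm_iff.mpr h') hc, e⟩
    · obtain ⟨s, h, e⟩ := ihx h
      obtain ⟨s', h', e'⟩ := ihy h'
      exact ⟨_, .cmerge_step_step h h' hc, congrArg₂ DClass.par e e'⟩
  | @par x y hx hy ihx ihy =>
    rcases List.mem_append.mp hm with hm | hm
    · rcases mem_followList.mp hm with ⟨h, e⟩ | ⟨r, h, e⟩ <;> cases e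
      · exact ⟨_, .par_term_left (hx.aTerm_iff.mpr h) hy.pStep_one, rfl⟩
      · obtain ⟨s', h, e⟩ := ihx h
        exact ⟨_, .par_step_left h hy.pStep_one, congrArg (DClass.par · (cls γ y)) e⟩
    rcases List.mem_append.mp hm with hm | hm
    · rcases mem_followList.mp hm with ⟨h, e⟩ | ⟨r, h, e⟩ <;> cases e
      · exact ⟨_, .par_term_right hx.pStep_one (hy.aTerm_iff.mpr h), rfl⟩
      · obtain ⟨s', h, e⟩ := ihy h
        exact ⟨_, .par_step_right hx.pStep_one h,
          (par_comm_of_comm γ_comm _ _).trans (congrArg (DClass.par (cls γ x)) e)⟩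
    · obtain ⟨⟨a, _ | r⟩, h, ⟨b, _ | r'⟩, h', hc, e⟩ := mem_commList.mp hm <;> cases e
      · obtain ⟨s', h', e⟩ := ihy h'
        exact ⟨s', .par_term_step (hx.aTerm_iff.mpr h) h' hc, e⟩
      · obtain ⟨s', h, e⟩ := ihx h
        exact ⟨s', .par_step_term h (hy.aTerm_iff.mpr h') hc, e⟩
      · obtain ⟨s, h, e⟩ := ihx h
        obtain ⟨s', h', e'⟩ := ihy h'
        exact ⟨_, .par_step_step h h' hc, congrArg₂ DClass.par e e'⟩
  | encap H hx ih =>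
    obtain ⟨ha, _ | r, h, e⟩ := mem_encapList.mp hm <;> cases e
    obtain ⟨s', h, e⟩ := ih h
    exact ⟨_, .encap h ha, congrArg (DClass.encap H) e⟩

variable {R : ClosedTerm Act M → ClosedTerm Act M → Prop}

/-- Two related resolved terms are derivably equal if this holds for the related terms into which
they can evolve. -/
theorem IsProbBisim.cls_eq_of_resolved (γ_comm : ∀ a b : Option Act, γ a b = γ b a)
    (hR : IsProbBisim γ R) {n : ℕ}
    (ih : ∀ s s', depth s < n → depth s' < n → R s s' → cls γ s = cls γ s')
    {t t' : ClosedTerm Act M} (ht : Resolved t) (ht' : Resolved t')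
    (hn : depth t ≤ n) (hn' : depth t' ≤ n) (h : R t t') : cls γ t = cls γ t' := by
  have key : ∀ {t t' : ClosedTerm Act M}, Resolved t → Resolved t' → depth t ≤ n → depth t' ≤ n →
      R t t' → ∀ p ∈ summands γ t, ∃ q ∈ summands γ t', p.cls γ = q.cls γ := by
    rintro t t' ht ht' hn hn' h ⟨a, _ | s⟩ hp
    · exact ⟨(a, none), ht'.aTerm_iff.mp (hR.term _ _ h _ (ht.aTerm_iff.mpr hp)), rfl⟩
    -- From summand to action step, across the bisimulation, and back to a summand; `s₁` and `s₂`
    -- are below the depth bound, but `s` and `s₃` are reached by derivable equality only.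
    · obtain ⟨s₁, h₁, e₁⟩ := ht.exists_aStep γ_comm hp
      obtain ⟨s₂, h₂, hs⟩ := hR.step _ _ h _ _ h₁
      obtain ⟨s₃, h₃, e₃⟩ := ht'.exists_mem_summands γ_comm h₂
      have e₂ := ih s₁ s₂ (h₁.depth_lt.trans_le hn) (h₂.depth_lt.trans_le hn') hs
      exact ⟨_, h₃, congrArg (DClass.seq (DClass.const γ (some a))) (e₁.trans (e₂.trans e₃))⟩
  rw [ht.cls_eq_sumCls, ht'.cls_eq_sumCls]
  exact sumCls_eq_of_forall_mem (key ht ht' hn hn' h)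
    (key ht' ht hn' hn (hR.equivalence.symm h))

/-- The distributions of related terms agree on the classes of related terms. -/
theorem IsProbBisim.mapDomain_dist_eq (hR : IsProbBisim γ R) {t t' : ClosedTerm Act M}
    (h : R t t') :
    (dist t).mapDomain (Quotient.mk ⟨R, hR.equivalence⟩) =
      (dist t').mapDomain (Quotient.mk ⟨R, hR.equivalence⟩) := by
  classical
  -- The weight that the pushed-forward distribution gives to the class of `u` is the probability
  -- occurring in the third transfer property.
  have key : ∀ s u : ClosedTerm Act M,
      ((dist s).mapDomain (Quotient.mk ⟨R, hR.equivalence⟩) (Quotient.mk _ u)).1 =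
        probSet s {r | R u r} := by
    intro s u
    rw [probSet_eq_sum, Finsupp.mapDomain, Finsupp.sum_apply]
    congr 1
    refine Finsupp.sum_congr fun r _ => ?_
    rw [Finsupp.single_apply]
    refine if_congr ?_ rfl rfl
    rw [Quotient.eq]
    exact ⟨hR.equivalence.symm, hR.equivalence.symm⟩
  ext q
  induction q using Quotient.ind with | _ u
  rw [key, key, hR.prob t t' h u]

/-- Within a depth bound, the value of a resolved term in the cone factors through its `R`-class, so
a term's value is determined by its distribution on `R`-classes. -/
theorem IsProbBisim.cls_eq (γ_comm : ∀ a b : Option Act, γ a b = γ b a) (hR : IsProbBisim γ R)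
    {t t' : ClosedTerm Act M} (h : R t t') : cls γ t = cls γ t' := by
  classical
  obtain ⟨n, hn, hn'⟩ : ∃ n, depth t ≤ n ∧ depth t' ≤ n := ⟨_, le_max_left _ _, le_max_right _ _⟩
  induction n using Nat.strong_induction_on generalizing t t' with
  | _ n ih =>
    have resolved : ∀ {r r' : ClosedTerm Act M}, Resolved r → Resolved r' → depth r ≤ n →
        depth r' ≤ n → R r r' → cls γ r = cls γ r' :=
      hR.cls_eq_of_resolved γ_comm fun s s' hs hs' h =>
        ih (max (depth s) (depth s')) (max_lt hs hs') h (le_max_left _ _) (le_max_right _ _)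
    let S : Setoid (ClosedTerm Act M) := ⟨R, hR.equivalence⟩
    -- The value at a class is taken from some resolved representative of depth at most `n`; by
    -- `resolved` the choice is immaterial. The default `0` is never met on the supports considered.
    let g : Quotient S → Cone M (DClass M γ) := fun q =>
      if h : ∃ r, Resolved r ∧ depth r ≤ n ∧ Quotient.mk S r = q then Cone.of (cls γ h.choose)
      else 0
    have hg : ∀ s : ClosedTerm Act M, depth s ≤ n → Cone.of (cls γ s) =
        Finsupp.linearCombination (nonNegSubsemiring M) g ((dist s).mapDomain (Quotient.mk S)) := by
      intro s hs
      rw [← linearCombination_dist, Finsupp.linearCombination_mapDomain,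
        Finsupp.linearCombination_apply, Finsupp.linearCombination_apply]
      refine Finsupp.sum_congr fun r hr => ?_
      obtain ⟨hr, hd⟩ := resolved_of_dist_ne_zero (Finsupp.mem_support_iff.mp hr)
      have hex : ∃ r', Resolved r' ∧ depth r' ≤ n ∧ Quotient.mk S r' = Quotient.mk S r :=
        ⟨r, hr, hd.trans hs, rfl⟩
      have e : g (Quotient.mk S r) = Cone.of (cls γ hex.choose) := dif_pos hex
      obtain ⟨h₁, h₂, h₃⟩ := hex.choose_spec
      rw [Function.comp_apply, e, resolved h₁ hr h₂ (hd.trans hs) (Quotient.exact h₃)]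
    apply Cone.of_injective (M := M)
    rw [hg t hn, hg t' hn', hR.mapDomain_dist_eq h]

end Completeness

end PACP

theorem mainTheorem1 {Act : Type u} {M : Type v} [SignedCancellationMeadow M]
    (γ : Option Act → Option Act → Option Act)
    (γ_comm : ∀ a b : Option Act, γ a b = γ b a)
    (γ_assoc : ∀ a b c : Option Act, γ (γ a b) c = γ a (γ b c))
    (γ_dead : ∀ a : Option Act, γ none a = none)
    (t t' : PACP.ClosedTerm Act M) (h : PACP.Bisimilar γ t t') :
    PACP.Derivable γ (PACP.Term.ofClosed ℕ t) (PACP.Term.ofClosed ℕ t') := by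
  obtain ⟨R, hR, h⟩ := h
  -- The derivation found involves closed terms only and remains one when variables are admitted.
  exact (PACP.cls_eq.mp (hR.cls_eq γ_comm h)).ofClosed ℕ
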